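/- Let $0<r<n$, $J=I_r\oplus -I_{n-r}$, $\alpha\neq\beta$ in $\mathbb C$, and $$A=\begin{bmatrix}\alpha I_r & C\\ D&\beta I_{n-r}\end{bmatrix}\in M_n(\mathbb C),$$ where $C,D$ are not both zero. Write $[x,y]_J=y^*Jx$, let $W^J_{\pm}(A)=\{[Ax,x]_J : x\in\mathbb C^n,\ [x,x]_J=\pm1\}$, and let $W^J(A)=W^J_+(A)\cup(-W^J_-(A))$ be the Krein space numerical range of $A$. With $A^\#=JA^*J$, $\Re^J(A)=\frac12(A+A^\#)$ and $\Im^J(A)=\frac1{2i}(A-A^\#)$, let $C^J(A)$ be the indefinite Kippenhahn curve, that is, the real part of the algebraic curve whose equation in homogeneous line coordinates is $\det(u\,\Re^J(A)+v\,\Im^J(A)+w\,I_n)=0$; its components are those given by the irreducible factors of this polynomial. For $\theta\in\mathbb R$ and $n\le 2r$ let $$M(\theta)=C^*C+DD^*-2\Re(e^{-2i\theta}DC),\qquad \Re(X)=\tfrac12(X+X^*),$$ and for $n>2r$ define $M(\theta)$ by the same formula with $C$ and $D$ interchanged. Let $\|\cdot\|$ be the spectral norm. For $N,m>0$ with $N^2+m^2=|f-g|^2$,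 the hyperbola with foci $f,g$, transverse axis of length $N$ and non-transverse axis of length $m$ is $\{z:\big||z-f|-|z-g|\big|=N\}$, and the hyperbolic disc bounded by it is $\{z:\big||z-f|-|z-g|\big|\ge N\}$. Assume that the spectrum of $M(\theta)$ does not depend on $\theta$. Then $W^J(A)$ is a (non-degenerate) hyperbolic disc with foci $\alpha,\beta$ and non-transverse axis of length $\|C-D^*\|$ if and only if $\|C-D^*\|<|\alpha-\beta|$. In this case, let $\mu_1,\dots,\mu_s$ be the distinct non-zero eigenvalues of $M(0)$. The hyperbolic components of $C^J(A)$ (the components that are non-degenerate hyperbolas) are exactly the hyperbolas with foci $\alpha,\beta$ and non-transverse axes of lengths $\sqrt{\mu_1},\dots,\sqrt{\mu_s}$, and they are nested: for any two distinct ones, the hyperbolic disc bounded by one lies in the interior of the hyperbolic disc bounded by the other. -/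

import Mathlib

open Matrix

noncomputable section

/-! ### The Krein space numerical range -/

/-- The indefinite inner product `[x, y]_H = y^* H x`. -/
def kreinInner {ι : Type*} [Fintype ι] (H : Matrix ι ι ℂ) (x y : ι → ℂ) : ℂ :=
  star y ⬝ᵥ (H *ᵥ x)

/-- `W_+^H(A) = {[Ax, x]_H : [x, x]_H = 1}`. -/
def kreinRangePos {ι : Type*} [Fintype ι] (H A : Matrix ι ι ℂ) : Set ℂ :=
  {w | ∃ x : ι → ℂ, kreinInner H x x = 1 ∧ w = kreinInner H (A *ᵥ x) x}

/-- `W_-^H(A) = {[Ax, x]_H : [x, x]_H = -1}`. -/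
def kreinRangeNeg {ι : Type*} [Fintype ι] (H A : Matrix ι ι ℂ) : Set ℂ :=
  {w | ∃ x : ι → ℂ, kreinInner H x x = -1 ∧ w = kreinInner H (A *ᵥ x) x}

/-- The Krein space numerical range `W^H(A) = -W_-^H(A) ∪ W_+^H(A)`. -/
def kreinRange {ι : Type*} [Fintype ι] (H A : Matrix ι ι ℂ) : Set ℂ :=
  {w | -w ∈ kreinRangeNeg H A} ∪ kreinRangePos H A

/-! ### The block matrices -/

/-- `J = I_r ⊕ -I_s`. -/
def blockJ (r s : ℕ) : Matrix (Fin r ⊕ Fin s) (Fin r ⊕ Fin s) ℂ :=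
  Matrix.fromBlocks 1 0 0 (-1)

/-- The block matrix with diagonal blocks `α I_r`, `β I_s` and off-diagonal blocks `C`, `D`. -/
def blockA {r s : ℕ} (α β : ℂ) (C : Matrix (Fin r) (Fin s) ℂ) (D : Matrix (Fin s) (Fin r) ℂ) :
    Matrix (Fin r ⊕ Fin s) (Fin r ⊕ Fin s) ℂ :=
  Matrix.fromBlocks (α • 1) C D (β • 1)

/-- The Hermitian part `(X + X^*) / 2`. -/
def hermPart {ι : Type*} (X : Matrix ι ι ℂ) : Matrix ι ι ℂ :=
  (1 / 2 : ℂ) • (X + Xᴴ)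

/-- `M(θ) = C^* C + D D^* - 2 Re (e^{-2iθ} D C)`. -/
def blockM {r s : ℕ} (C : Matrix (Fin r) (Fin s) ℂ) (D : Matrix (Fin s) (Fin r) ℂ) (θ : ℝ) :
    Matrix (Fin s) (Fin s) ℂ :=
  Cᴴ * C + D * Dᴴ - (2 : ℂ) • hermPart (Complex.exp (-2 * Complex.I * θ) • (D * C))

/-- The spectrum of `M(θ)`; when `s > r` the roles of `C` and `D` are interchanged, so that
`M(θ)` always has order `min r s`. -/
def specM {r s : ℕ} (C : Matrix (Fin r) (Fin s) ℂ) (D : Matrix (Fin s) (Fin r) ℂ) (θ : ℝ) :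
    Set ℂ :=
  if s ≤ r then spectrum ℂ (blockM C D θ) else spectrum ℂ (blockM D C θ)

open scoped Matrix.Norms.L2Operator in
/-- The spectral norm (operator norm for the Euclidean norms). -/
def spectralNormMat {r s : ℕ} (X : Matrix (Fin r) (Fin s) ℂ) : ℝ := ‖X‖

/-! ### Hyperbolas in the complex plane -/

/-- The set of points whose distances to `f` and `g` differ by exactly `N`. -/
def hyperbola (f g : ℂ) (N : ℝ) : Set ℂ := {z | |‖z - f‖ - ‖z - g‖| = N}

/-- The closed region bounded by `hyperbola f g N` and containing the foci. -/
def hyperbolicDisc (f g : ℂ) (N : ℝ) : Set ℂ := {z | N ≤ |‖z - f‖ - ‖z - g‖|}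

/-- `K` is a non-degenerate hyperbola with foci `f`, `g` and non-transverse axis of length `m`
(its transverse axis has length `N`). -/
def IsHyperbolaWith (K : Set ℂ) (f g : ℂ) (m : ℝ) : Prop :=
  ∃ N : ℝ, 0 < N ∧ 0 < m ∧ N ^ 2 + m ^ 2 = ‖f - g‖ ^ 2 ∧ K = hyperbola f g N

/-- `K` is a non-degenerate hyperbola. -/
def IsHyperbola (K : Set ℂ) : Prop :=
  ∃ (f g : ℂ) (m : ℝ), IsHyperbolaWith K f g m

/-- `S` is a (non-degenerate) hyperbolic disc with foci `f`, `g` and non-transverse axis of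
length `m`. -/
def IsHyperbolicDiscWith (S : Set ℂ) (f g : ℂ) (m : ℝ) : Prop :=
  ∃ N : ℝ, 0 < N ∧ 0 < m ∧ N ^ 2 + m ^ 2 = ‖f - g‖ ^ 2 ∧ S = hyperbolicDisc f g N

/-- `K` and `K'` are non-degenerate hyperbolas, and the closed disc bounded by `K` lies in the
interior of the one bounded by `K'`. -/
def HyperbolaInside (K K' : Set ℂ) : Prop :=
  ∃ (f g f' g' : ℂ) (N N' m m' : ℝ),
    (0 < N ∧ 0 < m ∧ N ^ 2 + m ^ 2 = ‖f - g‖ ^ 2 ∧ K = hyperbola f g N) ∧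
    (0 < N' ∧ 0 < m' ∧ N' ^ 2 + m' ^ 2 = ‖f' - g'‖ ^ 2 ∧ K' = hyperbola f' g' N') ∧
    hyperbolicDisc f g N ⊆ interior (hyperbolicDisc f' g' N')

/-! ### The indefinite Kippenhahn curve -/

/-- The `J`-adjoint `A^# = J A^* J`. -/
def jAdjoint {ι : Type*} [Fintype ι] (J A : Matrix ι ι ℂ) : Matrix ι ι ℂ := J * Aᴴ * J

/-- `Re^J(A) = (A + A^#) / 2`. -/
def jRe {ι : Type*} [Fintype ι] (J A : Matrix ι ι ℂ) : Matrix ι ι ℂ :=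
  (1 / 2 : ℂ) • (A + jAdjoint J A)

/-- `Im^J(A) = (A - A^#) / (2i)`. -/
def jIm {ι : Type*} [Fintype ι] (J A : Matrix ι ι ℂ) : Matrix ι ι ℂ :=
  (1 / (2 * Complex.I) : ℂ) • (A - jAdjoint J A)

/-- The polynomial `det (u Re^J(A) + v Im^J(A) + w I)` in the line coordinates
`(u, v, w) = (X 0, X 1, X 2)`. -/
def kippenhahnPoly {ι : Type*} [Fintype ι] [DecidableEq ι] (J A : Matrix ι ι ℂ) :
    MvPolynomial (Fin 3) ℂ :=
  Matrix.det
    ((MvPolynomial.X 0 : MvPolynomial (Fin 3) ℂ) • (jRe J A).map MvPolynomial.C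
      + (MvPolynomial.X 1 : MvPolynomial (Fin 3) ℂ) • (jIm J A).map MvPolynomial.C
      + (MvPolynomial.X 2 : MvPolynomial (Fin 3) ℂ) •
          (1 : Matrix ι ι (MvPolynomial (Fin 3) ℂ)))

/-- The gradient of `p` at `ξ`: homogeneous coordinates of the point dual to the tangent line of
`p = 0` at `ξ`. -/
def polyGrad (p : MvPolynomial (Fin 3) ℂ) (ξ : Fin 3 → ℂ) : Fin 3 → ℂ :=
  fun i => MvPolynomial.eval ξ (MvPolynomial.pderiv i p)

/-- The dual of the plane projective curve `p = 0`, given by its homogeneous coordinate vectors: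
the projective Zariski closure of the image of the smooth points of `p = 0` under the Gauss map.
In other words, the curve whose equation in line coordinates is `p = 0`. -/
def dualCurve (p : MvPolynomial (Fin 3) ℂ) : Set (Fin 3 → ℂ) :=
  {P | P ≠ 0 ∧ ∀ (d : ℕ) (G : MvPolynomial (Fin 3) ℂ), G.IsHomogeneous d →
    (∀ ξ : Fin 3 → ℂ, MvPolynomial.eval ξ p = 0 → polyGrad p ξ ≠ 0 →
      MvPolynomial.eval (polyGrad p ξ) G = 0) →
    MvPolynomial.eval P G = 0}

/-- The real affine part of the dual curve, as a subset of the plane `ℂ`. -/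
def realDualCurve (p : MvPolynomial (Fin 3) ℂ) : Set ℂ :=
  {z | ![(z.re : ℂ), (z.im : ℂ), 1] ∈ dualCurve p}

/-- The components of the indefinite Kippenhahn curve `C^J(A)`: the real parts of the curves whose
line-coordinate equations are the irreducible factors of `det (u Re^J(A) + v Im^J(A) + w I)`.
The curve `C^J(A)` is the union of these sets. -/
def kippenhahnComponents {ι : Type*} [Fintype ι] [DecidableEq ι] (J A : Matrix ι ι ℂ) :
    Set (Set ℂ) :=
  {K | ∃ p : MvPolynomial (Fin 3) ℂ, Irreducible p ∧ p ∣ kippenhahnPoly J A ∧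
    K = realDualCurve p}

/-- The hyperbolic components of `C^J(A)`. -/
def hyperbolicComponents {ι : Type*} [Fintype ι] [DecidableEq ι] (J A : Matrix ι ι ℂ) :
    Set (Set ℂ) :=
  {K | K ∈ kippenhahnComponents J A ∧ IsHyperbola K}

end

/-!
# Hyperbolic Krein space numerical ranges

Let `B(θ) = e^{-iθ} C - e^{iθ} D^*` (`crossBlock`). Then `M(θ) = B(θ)^* B(θ)`, and interchanging `C`
and `D` gives `B(θ) B(θ)^*`. If the spectrum of `M(θ)` is constant, then so is `‖B(θ)‖`, with value
`m = ‖C - D^*‖` (`norm_crossBlock`). Since `Re (e^{-iθ} (y^* C z - z^* D y)) = Re (y^* B(θ) z)`, the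
values of `y^* C z - z^* D y` on unit vectors lie in the closed disc of radius `m` and fill its
boundary circle (`norm_crossForm_le`, `exists_crossForm_eq`). For `x = (y, z)` with
`[x, x]_J = σ = ±1` and `U = σ (|y|^2 + |z|^2)`, the point `σ [Ax, x]_J` is
`(α + β) / 2 + U (α - β) / 2 + σ (y^* C z - z^* D y)`, where `|y|^2 |z|^2 = (U^2 - 1) / 4`. So the
numerical range is a union of discs centred on the line through `α` and `β`, and completing the
square in `U` shows that this union is the hyperbolic disc (`kreinRange_blockA_eq`). Non-degeneracy
needs `m > 0`, which holds because `C` and `D` are not both zero (`spectralNormMat_sub_pos`).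

For the curve, the spectrum determines the characteristic polynomial of `M(θ)` up to finitely many
choices, so by continuity it is constant in `θ` (`charpoly_eq_of_spectrum_eq`). At a real line in
polar coordinates the Schur complement of `u Re^J(A) + v Im^J(A) + w I` involves `M(θ)` only, so
that the Kippenhahn polynomial is, up to powers of the line equation of one focus, the product over the
eigenvalues `μ` of `M(0)` of
`(α₁ u + α₂ v + w) (β₁ u + β₂ v + w) + (μ / 4) (u^2 + v^2)`
(`exists_kippenhahnPoly_factorization`). For `0 < μ ≤ m^2 < |α - β|^2` this conic is irreducible
(`irreducible_conicForm`) and its dual is the hyperbola with foci `α`, `β` and non-transverse axis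
`√μ` (`realDualCurve_conicForm`); for `μ = 0` it splits into the line equations of the two foci,
whose duals are points (`realDualCurve_lineForm`). Confocal hyperbolas are nested.
-/

/-! ### Hyperbolas and hyperbolic discs -/

/-- The quadratic polynomial that cuts out the hyperbola with foci `f`, `g` and transverse axis
`N`. In terms of the centred coordinate `e = 2z - f - g` and of `d = f - g` it is
`⟨d, e⟩ ^ 2 - N ^ 2 (|e| ^ 2 + |d| ^ 2 - N ^ 2)`; it is non-negative on the hyperbolic disc. -/
noncomputable def hyperbolaForm (f g : ℂ) (N : ℝ) (z : ℂ) : ℝ :=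
  ((f - g).re * (2 * z - f - g).re + (f - g).im * (2 * z - f - g).im) ^ 2
    - N ^ 2 * (‖2 * z - f - g‖ ^ 2 + ‖f - g‖ ^ 2 - N ^ 2)

theorem hyperbolaForm_eq_mul (f g : ℂ) (N : ℝ) (z : ℂ) :
    hyperbolaForm f g N z =
      ((‖z - f‖ - ‖z - g‖) ^ 2 - N ^ 2) * ((‖z - f‖ + ‖z - g‖) ^ 2 - N ^ 2) := by
  have h1 : ‖z - f‖ ^ 2 = (z.re - f.re) ^ 2 + (z.im - f.im) ^ 2 := by
    rw [Complex.sq_norm, Complex.normSq_apply]; simp; ring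
  have h2 : ‖z - g‖ ^ 2 = (z.re - g.re) ^ 2 + (z.im - g.im) ^ 2 := by
    rw [Complex.sq_norm, Complex.normSq_apply]; simp; ring
  have h3 : ((‖z - f‖ - ‖z - g‖) ^ 2 - N ^ 2) * ((‖z - f‖ + ‖z - g‖) ^ 2 - N ^ 2)
      = (‖z - f‖ ^ 2 - ‖z - g‖ ^ 2) ^ 2 - 2 * N ^ 2 * (‖z - f‖ ^ 2 + ‖z - g‖ ^ 2) + N ^ 4 := by
    ring
  rw [h3, h1, h2, hyperbolaForm, Complex.sq_norm, Complex.normSq_apply, Complex.sq_norm,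
    Complex.normSq_apply]
  simp
  ring

/-- The second factor in `hyperbolaForm_eq_mul` is positive, by the triangle inequality; the first
one therefore determines the sign of the form. -/
theorem sq_norm_add_norm_sub_pos {f g : ℂ} {N : ℝ} (hN : 0 ≤ N) (hlt : N < ‖f - g‖) (z : ℂ) :
    0 < (‖z - f‖ + ‖z - g‖) ^ 2 - N ^ 2 := by
  have : ‖f - g‖ ≤ ‖z - f‖ + ‖z - g‖ := by
    have h : f - g = -(z - f) + (z - g) := by ring
    rw [h]
    exact (norm_add_le _ _).trans_eq (by rw [norm_neg])
  nlinarith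

theorem mem_hyperbola_iff {f g : ℂ} {N : ℝ} (hN : 0 ≤ N) (hlt : N < ‖f - g‖) (z : ℂ) :
    z ∈ hyperbola f g N ↔ hyperbolaForm f g N z = 0 := by
  rw [hyperbolaForm_eq_mul, mul_eq_zero, or_iff_left (sq_norm_add_norm_sub_pos hN hlt z).ne',
    sub_eq_zero, sq_eq_sq_iff_abs_eq_abs, abs_of_nonneg hN]
  rfl

theorem mem_hyperbolicDisc_iff {f g : ℂ} {N : ℝ} (hN : 0 ≤ N) (hlt : N < ‖f - g‖) (z : ℂ) :
    z ∈ hyperbolicDisc f g N ↔ 0 ≤ hyperbolaForm f g N z := by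
  rw [hyperbolaForm_eq_mul, mul_nonneg_iff_of_pos_right (sq_norm_add_norm_sub_pos hN hlt z),
    sub_nonneg, sq_le_sq, abs_of_nonneg hN]
  rfl

theorem transverse_lt {N m d : ℝ} (hm : 0 < m) (hd : 0 ≤ d) (h : N ^ 2 + m ^ 2 = d ^ 2) :
    N < d := by nlinarith

theorem hyperbolicDisc_comm (f g : ℂ) (N : ℝ) : hyperbolicDisc f g N = hyperbolicDisc g f N := by
  ext z; simp [hyperbolicDisc, abs_sub_comm]

/-- A hyperbola meets its axis in two points. -/
theorem IsHyperbola.ne_singleton {K : Set ℂ} (hK : IsHyperbola K) (c : ℂ) : K ≠ {c} := by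
  obtain ⟨f, g, m, N, hN, hm, h, rfl⟩ := hK
  have hlt := transverse_lt hm (norm_nonneg _) h
  have hd : 0 < ‖f - g‖ := hN.trans hlt
  have key : ∀ t : ℝ, t ^ 2 = (N / ‖f - g‖) ^ 2 →
      (f + g + t * (f - g)) / 2 ∈ hyperbola f g N := by
    intro t ht
    rw [mem_hyperbola_iff hN.le hlt, hyperbolaForm]
    have h1 : 2 * ((f + g + t * (f - g)) / 2) - f - g = t * (f - g) := by ring
    have h2 : ‖f - g‖ ^ 2 = (f - g).re ^ 2 + (f - g).im ^ 2 := by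
      rw [Complex.sq_norm, Complex.normSq_apply]; ring
    have ht' : t ^ 2 * ‖f - g‖ ^ 2 = N ^ 2 := by rw [ht]; field_simp
    rw [h1, norm_mul, Complex.re_ofReal_mul, Complex.im_ofReal_mul, mul_pow, Complex.norm_real,
      Real.norm_eq_abs, sq_abs, ht']
    have : ((f - g).re * (t * (f - g).re) + (f - g).im * (t * (f - g).im)) ^ 2
        = (t ^ 2 * ‖f - g‖ ^ 2) * ‖f - g‖ ^ 2 := by rw [h2]; ring
    rw [this, ht']; ring
  intro hc
  have h1 := key (N / ‖f - g‖) rfl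
  have h2 := key (-(N / ‖f - g‖)) (by ring)
  rw [hc, Set.mem_singleton_iff] at h1 h2
  have h3 : ((N / ‖f - g‖ : ℝ) : ℂ) * (f - g) = 0 := by
    have := h1.trans h2.symm
    push_cast at this ⊢
    linear_combination this
  rcases mul_eq_zero.1 h3 with h4 | h4
  · exact (div_pos hN hd).ne' (by exact_mod_cast h4)
  · rw [h4, norm_zero] at hd; exact hd.false

/-- Of two hyperbolas with common foci, the one with the longer transverse axis lies inside. -/
theorem hyperbolaInside_of_lt {f g : ℂ} {N N' m m' : ℝ} (hN' : 0 < N') (hm : 0 < m) (hm' : 0 < m')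
    (h : N ^ 2 + m ^ 2 = ‖f - g‖ ^ 2) (h' : N' ^ 2 + m' ^ 2 = ‖f - g‖ ^ 2) (hlt : N' < N) :
    HyperbolaInside (hyperbola f g N) (hyperbola f g N') := by
  refine ⟨f, g, f, g, N, N', m, m', ⟨hN'.trans hlt, hm, h, rfl⟩, ⟨hN', hm', h', rfl⟩, ?_⟩
  have hopen : IsOpen {z : ℂ | N' < |‖z - f‖ - ‖z - g‖|} :=
    isOpen_lt continuous_const (by fun_prop)
  have hsub : {z : ℂ | N' < |‖z - f‖ - ‖z - g‖|} ⊆ hyperbolicDisc f g N' :=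
    fun z hz => show N' ≤ _ from le_of_lt hz
  exact fun z hz => interior_maximal hsub hopen (hlt.trans_le hz)

theorem IsHyperbolaWith.inside_or_inside {f g : ℂ} {m m' : ℝ} {K K' : Set ℂ}
    (hK : IsHyperbolaWith K f g m) (hK' : IsHyperbolaWith K' f g m') (hne : K ≠ K') :
    HyperbolaInside K K' ∨ HyperbolaInside K' K := by
  obtain ⟨N, hN, hm, h, rfl⟩ := hK
  obtain ⟨N', hN', hm', h', rfl⟩ := hK'
  rcases lt_trichotomy N N' with hlt | heq | hlt
  · exact Or.inr (hyperbolaInside_of_lt hN hm' hm h' h hlt)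
  · exact absurd (heq ▸ rfl) hne
  · exact Or.inl (hyperbolaInside_of_lt hN' hm hm' h h' hlt)

theorem sq_norm_sub_smul (d e : ℂ) (U : ℝ) :
    ‖e - U * d‖ ^ 2 = ‖e‖ ^ 2 - 2 * U * (d.re * e.re + d.im * e.im) + U ^ 2 * ‖d‖ ^ 2 := by
  rw [Complex.sq_norm, Complex.normSq_apply, Complex.sq_norm, Complex.normSq_apply,
    Complex.sq_norm, Complex.normSq_apply]
  simp
  ring

/-- The closed disc with centre `(f + g) / 2 + U (f - g) / 2` and radius `m √(U ^ 2 - 1) / 2` is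
contained in the hyperbolic disc; everything is doubled to avoid fractions. -/
theorem mem_hyperbolicDisc_of_mem_closedBall {f g : ℂ} {N m : ℝ} (hN : 0 < N) (hm : 0 < m)
    (h : N ^ 2 + m ^ 2 = ‖f - g‖ ^ 2) {z : ℂ} {U : ℝ}
    (hU : ‖2 * z - f - g - U * (f - g)‖ ^ 2 ≤ m ^ 2 * (U ^ 2 - 1)) :
    z ∈ hyperbolicDisc f g N := by
  rw [mem_hyperbolicDisc_iff hN.le (transverse_lt hm (norm_nonneg _) h), hyperbolaForm]
  rw [sq_norm_sub_smul] at hU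
  set q := (f - g).re * (2 * z - f - g).re + (f - g).im * (2 * z - f - g).im
  set E := ‖2 * z - f - g‖ ^ 2
  rw [← h] at hU ⊢
  -- The quadratic polynomial in `U` takes a non-positive value, so its discriminant is `≥ 0`.
  have h1 : N ^ 2 * U ^ 2 - 2 * U * q + E + m ^ 2 ≤ 0 := by linarith
  have h2 := mul_nonneg (sq_nonneg N) (neg_nonneg.2 h1)
  nlinarith [sq_nonneg (q - N ^ 2 * U)]

theorem exists_mem_sphere_of_mem_hyperbolicDisc_aux {f g : ℂ} {N m : ℝ} (hN : 0 < N) (hm : 0 < m)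
    (h : N ^ 2 + m ^ 2 = ‖f - g‖ ^ 2) {z : ℂ} (hz : z ∈ hyperbolicDisc f g N)
    (hpos : 0 ≤ (f - g).re * (2 * z - f - g).re + (f - g).im * (2 * z - f - g).im) :
    ∃ U : ℝ, 1 ≤ U ∧ ‖2 * z - f - g - U * (f - g)‖ ^ 2 = m ^ 2 * (U ^ 2 - 1) := by
  rw [mem_hyperbolicDisc_iff hN.le (transverse_lt hm (norm_nonneg _) h), hyperbolaForm] at hz
  have hcs : ((f - g).re * (2 * z - f - g).re + (f - g).im * (2 * z - f - g).im) ^ 2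
      ≤ ‖f - g‖ ^ 2 * ‖2 * z - f - g‖ ^ 2 := by
    rw [Complex.sq_norm, Complex.normSq_apply, Complex.sq_norm, Complex.normSq_apply]
    nlinarith [sq_nonneg ((f - g).re * (2 * z - f - g).im - (f - g).im * (2 * z - f - g).re)]
  have hform := sq_norm_sub_smul (f - g) (2 * z - f - g)
  set q := (f - g).re * (2 * z - f - g).re + (f - g).im * (2 * z - f - g).im
  set E := ‖2 * z - f - g‖ ^ 2
  rw [← h] at hz hcs hform
  have hNN : 0 < N ^ 2 := by positivity
  have hmm : 0 < m ^ 2 := by positivity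
  have hE : N ^ 2 ≤ E := by nlinarith
  have hq : N ^ 2 ≤ q := by
    refine abs_le_of_sq_le_sq' ?_ hpos |>.2
    nlinarith
  -- The vertex of the quadratic polynomial in `U`.
  have hU0 : 1 ≤ q / N ^ 2 := by rwa [one_le_div hNN]
  let φ : ℝ → ℝ := fun U => ‖2 * z - f - g - U * (f - g)‖ ^ 2 - m ^ 2 * (U ^ 2 - 1)
  have hφ : Continuous φ := by fun_prop
  have h1 : 0 ≤ φ 1 := by simp only [φ]; nlinarith [sq_nonneg ‖2 * z - f - g - (1 : ℝ) * (f - g)‖]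
  have h2 : φ (q / N ^ 2) ≤ 0 := by
    simp only [φ]
    rw [hform]
    have : E - 2 * (q / N ^ 2) * q + (q / N ^ 2) ^ 2 * (N ^ 2 + m ^ 2)
        - m ^ 2 * ((q / N ^ 2) ^ 2 - 1) = -(q ^ 2 - N ^ 2 * (E + m ^ 2)) / N ^ 2 := by
      field_simp; ring
    rw [this]
    apply div_nonpos_of_nonpos_of_nonneg _ hNN.le
    linarith
  obtain ⟨U, hU, hU'⟩ := intermediate_value_Icc' hU0 hφ.continuousOn ⟨h2, h1⟩
  exact ⟨U, hU.1, sub_eq_zero.1 hU'⟩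

/-- The hyperbolic disc is swept out by circles centred on its axis. -/
theorem exists_mem_sphere_of_mem_hyperbolicDisc {f g : ℂ} {N m : ℝ} (hN : 0 < N) (hm : 0 < m)
    (h : N ^ 2 + m ^ 2 = ‖f - g‖ ^ 2) {z : ℂ} (hz : z ∈ hyperbolicDisc f g N) :
    ∃ U : ℝ, 1 ≤ |U| ∧ ‖2 * z - f - g - U * (f - g)‖ ^ 2 = m ^ 2 * (U ^ 2 - 1) := by
  rcases le_total 0 ((f - g).re * (2 * z - f - g).re + (f - g).im * (2 * z - f - g).im)
    with hpos | hneg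
  · obtain ⟨U, hU, hU'⟩ := exists_mem_sphere_of_mem_hyperbolicDisc_aux hN hm h hz hpos
    exact ⟨U, hU.trans (le_abs_self U), hU'⟩
  · obtain ⟨U, hU, hU'⟩ := exists_mem_sphere_of_mem_hyperbolicDisc_aux (f := g) (g := f) hN hm
      (by rw [h, norm_sub_rev]) (hyperbolicDisc_comm f g N ▸ hz) (by simp at hneg ⊢; linarith)
    refine ⟨-U, by rw [abs_neg]; exact hU.trans (le_abs_self U), ?_⟩
    rw [neg_sq, ← hU']
    congr 2
    push_cast; ring

/-! ### The off-diagonal block and `M(θ)` -/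

/-- The rotated off-diagonal block `e^{-iθ} C - e^{iθ} D^*`, so that
`M(θ) = (crossBlock C D θ)^* (crossBlock C D θ)`. -/
noncomputable def crossBlock {r s : ℕ} (C : Matrix (Fin r) (Fin s) ℂ) (D : Matrix (Fin s) (Fin r) ℂ)
    (θ : ℝ) : Matrix (Fin r) (Fin s) ℂ :=
  Complex.exp (-(Complex.I * θ)) • C - Complex.exp (Complex.I * θ) • Dᴴ

theorem star_exp_I_mul (θ : ℝ) :
    star (Complex.exp (Complex.I * θ)) = Complex.exp (-(Complex.I * θ)) := by
  rw [Complex.star_def, ← Complex.exp_conj]; simp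

theorem star_exp_neg_I_mul (θ : ℝ) :
    star (Complex.exp (-(Complex.I * θ))) = Complex.exp (Complex.I * θ) := by
  rw [← star_exp_I_mul, star_star]

theorem crossBlock_conjTranspose {r s : ℕ} (C : Matrix (Fin r) (Fin s) ℂ)
    (D : Matrix (Fin s) (Fin r) ℂ) (θ : ℝ) : (crossBlock C D θ)ᴴ = -crossBlock D C θ := by
  simp only [crossBlock, conjTranspose_sub, conjTranspose_smul, star_exp_I_mul,
    star_exp_neg_I_mul, conjTranspose_conjTranspose, neg_sub]

theorem blockM_eq {r s : ℕ} (C : Matrix (Fin r) (Fin s) ℂ) (D : Matrix (Fin s) (Fin r) ℂ) (θ : ℝ) :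
    blockM C D θ = (crossBlock C D θ)ᴴ * crossBlock C D θ := by
  have e1 : Complex.exp (Complex.I * θ) * Complex.exp (-(Complex.I * θ)) = 1 := by
    rw [← Complex.exp_add]; simp
  have e2 : Complex.exp (Complex.I * θ) * Complex.exp (Complex.I * θ)
      = Complex.exp (2 * Complex.I * θ) := by
    rw [← Complex.exp_add]; ring_nf
  have e3 : Complex.exp (-(Complex.I * θ)) * Complex.exp (-(Complex.I * θ))
      = Complex.exp (-2 * Complex.I * θ) := by
    rw [← Complex.exp_add]; ring_nf
  have e4 : star (Complex.exp (-2 * Complex.I * θ)) = Complex.exp (2 * Complex.I * θ) := by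
    rw [← e3, star_mul', star_exp_neg_I_mul, e2]
  rw [crossBlock_conjTranspose, blockM, hermPart, crossBlock, crossBlock, conjTranspose_smul, e4,
    conjTranspose_mul, smul_smul, ← e2, ← e3]
  simp only [neg_sub, Matrix.sub_mul, Matrix.mul_sub, Matrix.smul_mul, Matrix.mul_smul,
    smul_sub, smul_smul]
  rw [mul_comm (Complex.exp (-(Complex.I * θ))) (Complex.exp (Complex.I * θ)), e1]
  norm_num
  abel

theorem blockM_swap_eq {r s : ℕ} (C : Matrix (Fin r) (Fin s) ℂ) (D : Matrix (Fin s) (Fin r) ℂ)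
    (θ : ℝ) : blockM D C θ = crossBlock C D θ * (crossBlock C D θ)ᴴ := by
  rw [blockM_eq, crossBlock_conjTranspose, crossBlock_conjTranspose, Matrix.neg_mul,
    Matrix.mul_neg]

theorem crossBlock_zero {r s : ℕ} (C : Matrix (Fin r) (Fin s) ℂ) (D : Matrix (Fin s) (Fin r) ℂ) :
    crossBlock C D 0 = C - Dᴴ := by simp [crossBlock]

/-! ### The spectral norm of the off-diagonal block -/

section NormFacts
open scoped Matrix.Norms.L2Operator

theorem norm_sq_eq_spectralRadius {r s : ℕ} (B : Matrix (Fin r) (Fin s) ℂ) :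
    ‖B‖ * ‖B‖ = (spectralRadius ℂ (Bᴴ * B)).toReal := by
  rw [(isHermitian_conjTranspose_mul_self B).isSelfAdjoint.spectralRadius_eq_nnnorm,
    ← l2_opNorm_conjTranspose_mul_self]
  rfl

/-- The norm of the rotated block is read off the spectrum of `M(θ)`, hence does not depend on
`θ`. -/
theorem norm_crossBlock {r s : ℕ} {C : Matrix (Fin r) (Fin s) ℂ} {D : Matrix (Fin s) (Fin r) ℂ}
    (hspec : ∀ θ θ' : ℝ, specM C D θ = specM C D θ') (θ : ℝ) :
    ‖crossBlock C D θ‖ = spectralNormMat (C - Dᴴ) := by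
  have h : ‖crossBlock C D θ‖ * ‖crossBlock C D θ‖ = ‖crossBlock C D 0‖ * ‖crossBlock C D 0‖ := by
    have hs := hspec θ 0
    by_cases hle : s ≤ r
    · simp only [specM, if_pos hle, blockM_eq] at hs
      rw [norm_sq_eq_spectralRadius, norm_sq_eq_spectralRadius, spectralRadius, spectralRadius, hs]
    · simp only [specM, if_neg hle, blockM_swap_eq] at hs
      rw [← l2_opNorm_conjTranspose (crossBlock C D θ),
        ← l2_opNorm_conjTranspose (crossBlock C D 0),
        norm_sq_eq_spectralRadius, norm_sq_eq_spectralRadius, spectralRadius, spectralRadius,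
        conjTranspose_conjTranspose, conjTranspose_conjTranspose, hs]
  rw [(mul_self_inj_of_nonneg (norm_nonneg _) (norm_nonneg _)).1 h, crossBlock_zero]
  rfl

/-- If `C = D^*`, then all `M(θ)` have the spectrum of `M(0) = 0`, and this forces `C` and `D` to
vanish. -/
theorem spectralNormMat_sub_pos {r s : ℕ} {C : Matrix (Fin r) (Fin s) ℂ}
    {D : Matrix (Fin s) (Fin r) ℂ} (hCD : C ≠ 0 ∨ D ≠ 0)
    (hspec : ∀ θ θ' : ℝ, specM C D θ = specM C D θ') : 0 < spectralNormMat (C - Dᴴ) := by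
  refine (norm_nonneg (C - Dᴴ)).lt_of_ne fun h => ?_
  have key : ∀ θ, crossBlock C D θ = 0 := fun θ => by
    rw [← norm_eq_zero, norm_crossBlock hspec]; exact h.symm
  -- At `θ = 0` the block is `C - D^*`, at `θ = π / 2` it is `-i (C + D^*)`.
  have h0 := key 0
  have h1 := key (Real.pi / 2)
  rw [crossBlock_zero] at h0
  have e : Complex.exp (Complex.I * ((Real.pi / 2 : ℝ) : ℂ)) = Complex.I := by
    rw [mul_comm]; push_cast; exact Complex.exp_pi_div_two_mul_I
  rw [crossBlock, Complex.exp_neg, e, Complex.inv_I, neg_smul, ← sub_eq_zero.1 h0] at h1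
  have hC : C = 0 := by
    have h2 : (-2 * Complex.I) • C = 0 := by rw [← h1]; module
    exact (smul_eq_zero.1 h2).resolve_left (by simp)
  have hD : D = 0 := by
    rw [hC, zero_sub, neg_eq_zero, conjTranspose_eq_zero] at h0
    exact h0
  exact hCD.elim (· hC) (· hD)

theorem norm_toLp_mulVec_le {r s : ℕ} (B : Matrix (Fin r) (Fin s) ℂ) (z : Fin s → ℂ) :
    ‖WithLp.toLp 2 (B *ᵥ z)‖ ≤ ‖B‖ * ‖WithLp.toLp 2 z‖ :=
  l2_opNorm_mulVec B (WithLp.toLp 2 z)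

/-- The norm is attained, the unit sphere being compact. -/
theorem exists_unit_norm_mulVec_eq {r s : ℕ} (hs : 0 < s) (B : Matrix (Fin r) (Fin s) ℂ) :
    ∃ z : Fin s → ℂ, ‖WithLp.toLp 2 z‖ = 1 ∧ ‖WithLp.toLp 2 (B *ᵥ z)‖ = ‖B‖ := by
  have : Nonempty (Fin s) := ⟨⟨0, hs⟩⟩
  let T := (toEuclideanLin (𝕜 := ℂ) (m := Fin r) (n := Fin s)).trans
    LinearMap.toContinuousLinearMap B
  obtain ⟨x, hx, hx'⟩ := (isCompact_sphere (0 : EuclideanSpace ℂ (Fin s)) 1).exists_sSup_image_eq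
    (NormedSpace.sphere_nonempty.2 zero_le_one) (f := fun x => ‖T x‖) (by fun_prop)
  refine ⟨x.ofLp, by simpa using hx, ?_⟩
  rw [l2_opNorm_def]
  exact hx'.symm.trans (ContinuousLinearMap.sSup_sphere_eq_norm T)

theorem norm_star_dotProduct_le {r : ℕ} (y v : Fin r → ℂ) :
    ‖star y ⬝ᵥ v‖ ≤ ‖WithLp.toLp 2 y‖ * ‖WithLp.toLp 2 v‖ := by
  have := norm_inner_le_norm (𝕜 := ℂ) (WithLp.toLp 2 y) (WithLp.toLp 2 v)
  rwa [EuclideanSpace.inner_eq_star_dotProduct, dotProduct_comm] at this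

theorem star_dotProduct_self {r : ℕ} (y : Fin r → ℂ) :
    star y ⬝ᵥ y = ((‖WithLp.toLp 2 y‖ ^ 2 : ℝ) : ℂ) := by
  have := inner_self_eq_norm_sq_to_K (𝕜 := ℂ) (WithLp.toLp 2 y)
  rw [EuclideanSpace.inner_eq_star_dotProduct, dotProduct_comm] at this
  rw [this]; push_cast; rfl

theorem conj_star_dotProduct_mulVec {r s : ℕ} (D : Matrix (Fin s) (Fin r) ℂ) (y : Fin r → ℂ)
    (z : Fin s → ℂ) : star (star z ⬝ᵥ (D *ᵥ y)) = star y ⬝ᵥ (Dᴴ *ᵥ z) := by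
  rw [star_dotProduct, star_star, star_mulVec, ← dotProduct_mulVec]

/-- The contribution `y^* C z - z^* D y` of the off-diagonal blocks to `[Ax, x]_J`,
where `x = (y, z)`. -/
noncomputable def crossForm {r s : ℕ} (C : Matrix (Fin r) (Fin s) ℂ) (D : Matrix (Fin s) (Fin r) ℂ)
    (y : Fin r → ℂ) (z : Fin s → ℂ) : ℂ :=
  star y ⬝ᵥ (C *ᵥ z) - star z ⬝ᵥ (D *ᵥ y)

/-- The real part of the rotated form is the sesquilinear form of the rotated block, since
`e^{-iθ} z^* D y` and its conjugate `e^{iθ} y^* D^* z` have the same real part. -/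
theorem re_exp_mul_crossForm {r s : ℕ} (C : Matrix (Fin r) (Fin s) ℂ)
    (D : Matrix (Fin s) (Fin r) ℂ) (θ : ℝ) (y : Fin r → ℂ) (z : Fin s → ℂ) :
    (Complex.exp (-(Complex.I * θ)) * crossForm C D y z).re
      = (star y ⬝ᵥ (crossBlock C D θ *ᵥ z)).re := by
  have h : (Complex.exp (-(Complex.I * θ)) * (star z ⬝ᵥ (D *ᵥ y))).re
      = (Complex.exp (Complex.I * θ) * (star y ⬝ᵥ (Dᴴ *ᵥ z))).re := by
    rw [← conj_star_dotProduct_mulVec, ← star_exp_neg_I_mul, ← star_mul', Complex.star_def,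
      Complex.conj_re]
  rw [crossForm, mul_sub, Complex.sub_re, h, crossBlock, sub_mulVec, dotProduct_sub, smul_mulVec,
    smul_mulVec, dotProduct_smul, dotProduct_smul, Complex.sub_re, smul_eq_mul, smul_eq_mul]

theorem norm_exp_neg_I_mul (θ : ℝ) : ‖Complex.exp (-(Complex.I * θ))‖ = 1 := by
  rw [Complex.norm_exp]; simp

theorem exp_neg_arg_mul (w : ℂ) :
    Complex.exp (-(Complex.I * (Complex.arg w : ℝ))) * w = ‖w‖ := by
  conv_lhs => rw [← Complex.norm_mul_exp_arg_mul_I w]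
  rw [mul_left_comm, Complex.norm_mul_exp_arg_mul_I, mul_comm Complex.I, ← Complex.exp_add]
  simp

theorem norm_crossForm_le {r s : ℕ} {C : Matrix (Fin r) (Fin s) ℂ} {D : Matrix (Fin s) (Fin r) ℂ}
    (hspec : ∀ θ θ' : ℝ, specM C D θ = specM C D θ') (y : Fin r → ℂ) (z : Fin s → ℂ) :
    ‖crossForm C D y z‖
      ≤ spectralNormMat (C - Dᴴ) * (‖WithLp.toLp 2 y‖ * ‖WithLp.toLp 2 z‖) := by
  set w := crossForm C D y z with hw
  have h1 : ‖w‖ = (star y ⬝ᵥ (crossBlock C D w.arg *ᵥ z)).re := by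
    rw [← re_exp_mul_crossForm, ← hw, exp_neg_arg_mul, Complex.ofReal_re]
  rw [h1, ← norm_crossBlock hspec w.arg]
  calc _ ≤ ‖star y ⬝ᵥ (crossBlock C D w.arg *ᵥ z)‖ := Complex.re_le_norm _
    _ ≤ ‖WithLp.toLp 2 y‖ * ‖WithLp.toLp 2 (crossBlock C D w.arg *ᵥ z)‖ :=
        norm_star_dotProduct_le _ _
    _ ≤ ‖WithLp.toLp 2 y‖ * (‖crossBlock C D w.arg‖ * ‖WithLp.toLp 2 z‖) := by
        gcongr; exact norm_toLp_mulVec_le _ _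
    _ = _ := by ring

/-- On pairs of unit vectors the form `crossForm` attains every value of maximal modulus. -/
theorem exists_crossForm_eq {r s : ℕ} (hs : 0 < s) {C : Matrix (Fin r) (Fin s) ℂ}
    {D : Matrix (Fin s) (Fin r) ℂ} (hCD : C ≠ 0 ∨ D ≠ 0)
    (hspec : ∀ θ θ' : ℝ, specM C D θ = specM C D θ') {w : ℂ}
    (hw : ‖w‖ = spectralNormMat (C - Dᴴ)) :
    ∃ (y : Fin r → ℂ) (z : Fin s → ℂ), ‖WithLp.toLp 2 y‖ = 1 ∧ ‖WithLp.toLp 2 z‖ = 1 ∧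
      crossForm C D y z = w := by
  have hm := spectralNormMat_sub_pos hCD hspec
  set m := spectralNormMat (C - Dᴴ)
  obtain ⟨z, hz, hBz⟩ := exists_unit_norm_mulVec_eq hs (crossBlock C D w.arg)
  rw [norm_crossBlock hspec] at hBz
  set v := crossBlock C D w.arg *ᵥ z with hv
  change ‖WithLp.toLp 2 v‖ = m at hBz
  let y : Fin r → ℂ := ((m⁻¹ : ℝ) : ℂ) • v
  have hy : ‖WithLp.toLp 2 y‖ = 1 := by
    change ‖((m⁻¹ : ℝ) : ℂ) • WithLp.toLp 2 v‖ = 1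
    rw [norm_smul, Complex.norm_real, Real.norm_of_nonneg (inv_nonneg.2 hm.le), hBz,
      inv_mul_cancel₀ hm.ne']
  refine ⟨y, z, hy, hz, ?_⟩
  have hre : (Complex.exp (-(Complex.I * w.arg)) * crossForm C D y z).re = m := by
    rw [re_exp_mul_crossForm, ← hv]
    simp only [y]
    rw [star_smul, smul_dotProduct, star_dotProduct_self, hBz, Complex.star_def,
      Complex.conj_ofReal, smul_eq_mul, ← Complex.ofReal_mul, Complex.ofReal_re]
    field_simp
  have hle : ‖Complex.exp (-(Complex.I * w.arg)) * crossForm C D y z‖ ≤ m := by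
    rw [norm_mul, norm_exp_neg_I_mul, one_mul]
    simpa [hy, hz] using norm_crossForm_le hspec y z
  have heq : Complex.exp (-(Complex.I * w.arg)) * crossForm C D y z = m := by
    generalize Complex.exp (-(Complex.I * w.arg)) * crossForm C D y z = t at hre hle
    have h1 : ‖t‖ ^ 2 = t.re ^ 2 + t.im ^ 2 := by
      rw [Complex.sq_norm, Complex.normSq_apply]; ring
    have h2 : t.im = 0 := by
      have : ‖t‖ ^ 2 ≤ m ^ 2 := by gcongr
      rw [h1, hre] at this
      exact pow_eq_zero_iff two_ne_zero |>.1 (by nlinarith [sq_nonneg t.im])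
    apply Complex.ext <;> simp [hre, h2]
  rw [← hw, ← exp_neg_arg_mul w] at heq
  exact mul_left_cancel₀ (Complex.exp_ne_zero _) heq

end NormFacts

/-! ### The Krein space numerical range -/

theorem kreinInner_blockJ_self {r s : ℕ} (y : Fin r → ℂ) (z : Fin s → ℂ) :
    kreinInner (blockJ r s) (Sum.elim y z) (Sum.elim y z)
      = ((‖WithLp.toLp 2 y‖ ^ 2 - ‖WithLp.toLp 2 z‖ ^ 2 : ℝ) : ℂ) := by
  have hstar : star (Sum.elim y z) = Sum.elim (star y) (star z) := by
    ext i; rcases i with i | i <;> rfl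
  rw [kreinInner, blockJ, fromBlocks_mulVec, hstar, sumElim_dotProduct_sumElim]
  simp [star_dotProduct_self, neg_mulVec, sub_eq_add_neg]

theorem kreinInner_blockA {r s : ℕ} (α β : ℂ) (C : Matrix (Fin r) (Fin s) ℂ)
    (D : Matrix (Fin s) (Fin r) ℂ) (y : Fin r → ℂ) (z : Fin s → ℂ) :
    kreinInner (blockJ r s) (blockA α β C D *ᵥ Sum.elim y z) (Sum.elim y z)
      = α * (‖WithLp.toLp 2 y‖ ^ 2 : ℝ) - β * (‖WithLp.toLp 2 z‖ ^ 2 : ℝ) + crossForm C D y z := by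
  have hstar : star (Sum.elim y z) = Sum.elim (star y) (star z) := by
    ext i; rcases i with i | i <;> rfl
  rw [kreinInner, blockJ, blockA, fromBlocks_mulVec, fromBlocks_mulVec, hstar,
    sumElim_dotProduct_sumElim, ← star_dotProduct_self, ← star_dotProduct_self, crossForm]
  simp [neg_mulVec, smul_mulVec, dotProduct_add]
  ring

/-- Both halves of the numerical range at once: `σ` is the sign of `[x, x]_J`. -/
theorem mem_kreinRange_blockA_iff {r s : ℕ} (α β : ℂ) (C : Matrix (Fin r) (Fin s) ℂ)
    (D : Matrix (Fin s) (Fin r) ℂ) (w : ℂ) :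
    w ∈ kreinRange (blockJ r s) (blockA α β C D) ↔
      ∃ (σ : ℝ) (y : Fin r → ℂ) (z : Fin s → ℂ), (σ = 1 ∨ σ = -1) ∧
        ‖WithLp.toLp 2 y‖ ^ 2 - ‖WithLp.toLp 2 z‖ ^ 2 = σ ∧
        w = σ * (α * (‖WithLp.toLp 2 y‖ ^ 2 : ℝ) - β * (‖WithLp.toLp 2 z‖ ^ 2 : ℝ)
          + crossForm C D y z) := by
  have hx : ∀ x : Fin r ⊕ Fin s → ℂ, x = Sum.elim (x ∘ Sum.inl) (x ∘ Sum.inr) := fun x =>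
    (Sum.elim_comp_inl_inr x).symm
  constructor
  · rintro (⟨x, h1, h2⟩ | ⟨x, h1, h2⟩) <;> rw [hx x, kreinInner_blockJ_self] at h1 <;>
      rw [hx x, kreinInner_blockA] at h2
    · exact ⟨-1, _, _, Or.inr rfl, by exact_mod_cast h1, by rw [← h2]; simp⟩
    · exact ⟨1, _, _, Or.inl rfl, by exact_mod_cast h1, by rw [← h2]; simp⟩
  · rintro ⟨σ, y, z, rfl | rfl, h1, h2⟩
    · exact Or.inr ⟨Sum.elim y z, by rw [kreinInner_blockJ_self, h1, Complex.ofReal_one],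
        by rw [kreinInner_blockA, h2]; simp⟩
    · exact Or.inl ⟨Sum.elim y z, by rw [kreinInner_blockJ_self, h1]; simp,
        by rw [kreinInner_blockA, h2]; simp⟩

/-- With `U = σ (|y| ^ 2 + |z| ^ 2)`, the vectors `x = (y, z)` with given `U` produce points of the
closed disc with centre `(α + β) / 2 + U (α - β) / 2` and radius `m √(U ^ 2 - 1) / 2`, including its
whole boundary circle. The union over `|U| ≥ 1` of the discs, and already that of the circles, is
the hyperbolic disc. -/
theorem kreinRange_blockA_eq {r s : ℕ} (hs : 0 < s) {α β : ℂ} {C : Matrix (Fin r) (Fin s) ℂ}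
    {D : Matrix (Fin s) (Fin r) ℂ} (hCD : C ≠ 0 ∨ D ≠ 0)
    (hspec : ∀ θ θ' : ℝ, specM C D θ = specM C D θ') {N : ℝ} (hN : 0 < N)
    (h : N ^ 2 + spectralNormMat (C - Dᴴ) ^ 2 = ‖α - β‖ ^ 2) :
    kreinRange (blockJ r s) (blockA α β C D) = hyperbolicDisc α β N := by
  have hm := spectralNormMat_sub_pos hCD hspec
  have hle := norm_crossForm_le hspec
  have hex := fun w hw => exists_crossForm_eq hs hCD hspec (w := w) hw
  set m := spectralNormMat (C - Dᴴ)
  ext p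
  rw [mem_kreinRange_blockA_iff]
  constructor
  · rintro ⟨σ, y, z, hσ, h1, rfl⟩
    have hσ2 : σ ^ 2 = 1 := by rcases hσ with rfl | rfl <;> norm_num
    have hσn : ‖(σ : ℂ)‖ = 1 := by rcases hσ with rfl | rfl <;> norm_num
    have hw := hle y z
    set Y := ‖WithLp.toLp 2 y‖
    set Z := ‖WithLp.toLp 2 z‖
    apply mem_hyperbolicDisc_of_mem_closedBall (U := σ * (Y ^ 2 + Z ^ 2)) hN hm h
    have e1 : 2 * (σ * (α * (Y ^ 2 : ℝ) - β * (Z ^ 2 : ℝ) + crossForm C D y z)) - α - β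
        - ((σ * (Y ^ 2 + Z ^ 2) : ℝ) : ℂ) * (α - β) = σ * (2 * crossForm C D y z) := by
      have h1' : (σ : ℂ) * ((Y ^ 2 - Z ^ 2 : ℝ) : ℂ) = 1 := by
        rw [h1, ← Complex.ofReal_mul, ← sq, hσ2, Complex.ofReal_one]
      push_cast at h1' ⊢
      linear_combination (α + β) * h1'
    rw [e1, norm_mul, hσn, one_mul, norm_mul, mul_pow]
    have e2 : m ^ 2 * ((σ * (Y ^ 2 + Z ^ 2)) ^ 2 - 1) = ‖(2 : ℂ)‖ ^ 2 * (m * (Y * Z)) ^ 2 := by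
      have : (Y ^ 2 - Z ^ 2) ^ 2 = 1 := by rw [h1, hσ2]
      rw [Complex.norm_two, mul_pow σ, hσ2]
      linear_combination m ^ 2 * this
    rw [e2]
    gcongr
  · intro hp
    obtain ⟨U, hU, hU'⟩ := exists_mem_sphere_of_mem_hyperbolicDisc hN hm h hp
    obtain ⟨σ, hσ, hσU⟩ : ∃ σ : ℝ, (σ = 1 ∨ σ = -1) ∧ 1 ≤ σ * U := by
      rcases le_abs'.1 hU with h | h
      · exact ⟨-1, Or.inr rfl, by linarith⟩
      · exact ⟨1, Or.inl rfl, by linarith⟩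
    have hσ2 : σ ^ 2 = 1 := by rcases hσ with rfl | rfl <;> norm_num
    have hσn : ‖(σ : ℂ)‖ = 1 := by rcases hσ with rfl | rfl <;> norm_num
    -- Makes the two halves `(σ U ± σ) / 2` below non-negative.
    have habs : -1 ≤ σ ∧ σ ≤ 1 := by rcases hσ with rfl | rfl <;> norm_num
    -- The lengths of the components `y` and `z` of the vector to be found.
    obtain ⟨Y, hY0, hY⟩ : ∃ Y : ℝ, 0 ≤ Y ∧ Y ^ 2 = (σ * U + σ) / 2 :=
      ⟨_, Real.sqrt_nonneg _, Real.sq_sqrt (by linarith)⟩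
    obtain ⟨Z, hZ0, hZ⟩ : ∃ Z : ℝ, 0 ≤ Z ∧ Z ^ 2 = (σ * U - σ) / 2 :=
      ⟨_, Real.sqrt_nonneg _, Real.sq_sqrt (by linarith)⟩
    have hnorm : ‖2 * p - α - β - U * (α - β)‖ = 2 * m * (Y * Z) := by
      rw [← sq_eq_sq₀ (norm_nonneg _) (by positivity), hU', mul_pow, mul_pow Y, hY, hZ]
      linear_combination m ^ 2 * (1 - U ^ 2) * hσ2
    obtain ⟨w, hw, hw'⟩ : ∃ w : ℂ, ‖w‖ = m ∧
        σ * (2 * p - α - β - U * (α - β)) = 2 * ((Y * Z : ℝ) : ℂ) * w := by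
      rcases (mul_nonneg hY0 hZ0).eq_or_lt with h0 | h0
      · refine ⟨m, by simp [hm.le], ?_⟩
        rw [← h0, mul_zero, norm_eq_zero] at hnorm
        rw [hnorm, ← h0]; simp
      · refine ⟨σ * (2 * p - α - β - U * (α - β)) / (2 * ((Y * Z : ℝ) : ℂ)), ?_, ?_⟩
        · rw [norm_div, norm_mul, hσn, one_mul, hnorm, norm_mul, Complex.norm_two,
            Complex.norm_real, Real.norm_of_nonneg h0.le, div_eq_iff (by positivity)]
          ring
        · have : ((Y * Z : ℝ) : ℂ) ≠ 0 := by exact_mod_cast h0.ne'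
          field_simp
    obtain ⟨y, z, hy, hz, hyz⟩ := hex w hw
    have hYy : ‖WithLp.toLp 2 ((Y : ℂ) • y)‖ = Y := by
      change ‖(Y : ℂ) • WithLp.toLp 2 y‖ = Y
      rw [norm_smul, hy, Complex.norm_real, Real.norm_of_nonneg hY0, mul_one]
    have hZz : ‖WithLp.toLp 2 ((Z : ℂ) • z)‖ = Z := by
      change ‖(Z : ℂ) • WithLp.toLp 2 z‖ = Z
      rw [norm_smul, hz, Complex.norm_real, Real.norm_of_nonneg hZ0, mul_one]
    refine ⟨σ, (Y : ℂ) • y, (Z : ℂ) • z, hσ, by rw [hYy, hZz, hY, hZ]; ring, ?_⟩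
    have hcf : crossForm C D ((Y : ℂ) • y) ((Z : ℂ) • z) = ((Y * Z : ℝ) : ℂ) * w := by
      rw [← hyz, crossForm, crossForm]
      simp only [star_smul, smul_dotProduct, mulVec_smul, dotProduct_smul, smul_eq_mul,
        Complex.star_def, Complex.conj_ofReal]
      push_cast; ring
    have hσ2' : (σ : ℂ) ^ 2 = 1 := by exact_mod_cast hσ2
    rw [hYy, hZz, hY, hZ, hcf]
    have key : (2 * p - α - β - U * (α - β)) = 2 * σ * (((Y * Z : ℝ) : ℂ) * w) := by
      linear_combination σ * hw' - (2 * p - α - β - U * (α - β)) * hσ2'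
    push_cast at key ⊢
    linear_combination key / 2 - (α * (U + 1) / 2 - β * (U - 1) / 2) * hσ2'

/-! ### The eigenvalues of `M(θ)` and determinants of block matrices -/

theorem continuous_blockM {r s : ℕ} (C : Matrix (Fin r) (Fin s) ℂ) (D : Matrix (Fin s) (Fin r) ℂ) :
    Continuous (blockM C D) := by
  have h : Continuous (crossBlock C D) := by unfold crossBlock; fun_prop
  rw [show blockM C D = fun θ => (crossBlock C D θ)ᴴ * crossBlock C D θ from
    funext (blockM_eq C D)]
  exact h.matrix_conjTranspose.matrix_mul h

theorem isHermitian_blockM {r s : ℕ} (C : Matrix (Fin r) (Fin s) ℂ) (D : Matrix (Fin s) (Fin r) ℂ)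
    (θ : ℝ) : (blockM C D θ).IsHermitian := by
  rw [blockM_eq]; exact isHermitian_conjTranspose_mul_self _

open scoped ComplexOrder in
theorem eigenvalues_blockM_nonneg {r s : ℕ} (C : Matrix (Fin r) (Fin s) ℂ)
    (D : Matrix (Fin s) (Fin r) ℂ) (θ : ℝ) (i : Fin s) :
    0 ≤ (isHermitian_blockM C D θ).eigenvalues i := by
  have h : (blockM C D θ).PosSemidef := by
    rw [blockM_eq]; exact posSemidef_conjTranspose_mul_self _
  exact h.eigenvalues_nonneg i

theorem mem_spectrum_iff_eigenvalues {n : ℕ} {M : Matrix (Fin n) (Fin n) ℂ} (hM : M.IsHermitian)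
    (x : ℂ) : x ∈ spectrum ℂ M ↔ ∃ i, x = (hM.eigenvalues i : ℂ) := by
  rw [mem_spectrum_iff_isRoot_charpoly, hM.charpoly_eq, Polynomial.IsRoot, Polynomial.eval_prod,
    Finset.prod_eq_zero_iff]
  simp [sub_eq_zero]

/-- A continuous family of Hermitian matrices with constant spectrum has constant characteristic
polynomial: its values lie in a finite set. -/
theorem charpoly_eq_of_spectrum_eq {n : ℕ} {M : ℝ → Matrix (Fin n) (Fin n) ℂ} (hc : Continuous M)
    (hM : ∀ θ, (M θ).IsHermitian) (hspec : ∀ θ θ', spectrum ℂ (M θ) = spectrum ℂ (M θ'))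
    (θ θ' : ℝ) : (M θ).charpoly = (M θ').charpoly := by
  refine Polynomial.funext fun x => ?_
  have hcont : Continuous fun t => (M t).charpoly.eval x := by
    simp only [eval_charpoly]
    exact (continuous_const.sub hc).matrix_det
  have hfin : (spectrum ℂ (M 0)).Finite := by
    refine (Set.finite_range fun i => ((hM 0).eigenvalues i : ℂ)).subset fun y hy => ?_
    obtain ⟨i, rfl⟩ := (mem_spectrum_iff_eigenvalues (hM 0) y).1 hy
    exact ⟨i, rfl⟩
  have hsub : Set.range (fun t => (M t).charpoly.eval x) ⊆
      (fun f : Fin n → ℂ => ∏ i, (x - f i)) '' Set.pi Set.univ fun _ => spectrum ℂ (M 0) := by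
    rintro _ ⟨t, rfl⟩
    refine ⟨fun i => (hM t).eigenvalues i, fun i _ => ?_, ?_⟩
    · rw [hspec 0 t, mem_spectrum_iff_eigenvalues (hM t)]
      exact ⟨i, rfl⟩
    · simp [(hM t).charpoly_eq, Polynomial.eval_prod]
  have hcount := ((Set.Finite.pi' fun _ => hfin).subset (by simp [Set.pi]) |>.image _).subset hsub
    |>.countable
  exact hcount.isTotallyDisconnected _ subset_rfl (isPreconnected_range hcont) ⟨θ, rfl⟩ ⟨θ', rfl⟩

theorem det_smul_one_add_smul {n : ℕ} {M : Matrix (Fin n) (Fin n) ℂ} {μ : Fin n → ℂ}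
    (h : M.charpoly = ∏ i, (Polynomial.X - Polynomial.C (μ i))) (x y : ℂ) :
    (x • (1 : Matrix (Fin n) (Fin n) ℂ) + y • M).det = ∏ i, (x + y * μ i) := by
  by_cases hy : y = 0
  · simp [hy]
  · have e : x • (1 : Matrix (Fin n) (Fin n) ℂ) + y • M = (-y) • (scalar (Fin n) (-x / y) - M) := by
      rw [smul_sub, scalar_apply, ← smul_one_eq_diagonal, smul_smul]
      rw [show -y * (-x / y) = x by field_simp]
      module
    rw [e, det_smul, ← eval_charpoly, h, Polynomial.eval_prod, Fintype.card_fin,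
      ← Fin.prod_const, ← Finset.prod_mul_distrib]
    refine Finset.prod_congr rfl fun i _ => ?_
    simp
    field_simp
    ring

theorem det_fromBlocks_smul_one₁₁ {r s : ℕ} (a b : ℂ) (P : Matrix (Fin r) (Fin s) ℂ)
    (Q : Matrix (Fin s) (Fin r) ℂ) :
    (fromBlocks (a • 1) P Q (b • 1)).det * a ^ s = a ^ r * ((a * b) • 1 - Q * P).det := by
  have h : fromBlocks (a • 1) P Q (b • 1) * fromBlocks 1 (-P) 0 (a • 1)
      = fromBlocks (a • 1) 0 Q ((a * b) • 1 - Q * P) := by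
    rw [fromBlocks_multiply]
    congr 1 <;> simp [smul_smul, sub_eq_add_neg, add_comm]
  have := congrArg det h
  rw [det_mul, det_fromBlocks_zero₂₁, det_fromBlocks_zero₁₂] at this
  simpa [det_smul] using this

theorem det_fromBlocks_smul_one₂₂ {r s : ℕ} (a b : ℂ) (P : Matrix (Fin r) (Fin s) ℂ)
    (Q : Matrix (Fin s) (Fin r) ℂ) :
    (fromBlocks (a • 1) P Q (b • 1)).det * b ^ r = b ^ s * ((a * b) • 1 - P * Q).det := by
  have h : fromBlocks (a • 1) P Q (b • 1) * fromBlocks (b • 1) 0 (-Q) 1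
      = fromBlocks ((a * b) • 1 - P * Q) P 0 (b • 1) := by
    rw [fromBlocks_multiply]
    congr 1 <;> simp [smul_smul, mul_comm, sub_eq_add_neg]
  have := congrArg det h
  rw [det_mul, det_fromBlocks_zero₂₁, det_fromBlocks_zero₁₂] at this
  rw [mul_comm (b ^ s)]
  simpa [det_smul] using this

/-- At the real line with coordinates `(ρ cos θ, ρ sin θ, w)` the off-diagonal blocks of
`u Re^J(A) + v Im^J(A) + w I` are multiples of the rotated blocks whose Gram matrix is `M(θ)`. -/
theorem pencil_eq_fromBlocks {r s : ℕ} (α β : ℂ) (C : Matrix (Fin r) (Fin s) ℂ)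
    (D : Matrix (Fin s) (Fin r) ℂ) (ρ θ : ℝ) (w : ℂ) :
    ((ρ * Real.cos θ : ℝ) : ℂ) • jRe (blockJ r s) (blockA α β C D)
        + ((ρ * Real.sin θ : ℝ) : ℂ) • jIm (blockJ r s) (blockA α β C D) + w • 1
      = fromBlocks ((((ρ * Real.cos θ : ℝ) : ℂ) * α.re + ((ρ * Real.sin θ : ℝ) : ℂ) * α.im + w) • 1)
          ((ρ / 2 : ℂ) • crossBlock C D θ) ((ρ / 2 : ℂ) • crossBlock D C θ)
          ((((ρ * Real.cos θ : ℝ) : ℂ) * β.re + ((ρ * Real.sin θ : ℝ) : ℂ) * β.im + w) • 1) := by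
  have hadj : jAdjoint (blockJ r s) (blockA α β C D)
      = fromBlocks (star α • 1) (-Dᴴ) (-Cᴴ) (star β • 1) := by
    rw [jAdjoint, blockJ, blockA, fromBlocks_conjTranspose, fromBlocks_multiply,
      fromBlocks_multiply]
    simp
  have e1 : Complex.exp (Complex.I * θ) = Real.cos θ + Real.sin θ * Complex.I := by
    rw [mul_comm, Complex.exp_mul_I, Complex.ofReal_cos, Complex.ofReal_sin]
  have e2 : Complex.exp (-(Complex.I * θ)) = Real.cos θ - Real.sin θ * Complex.I := by
    rw [← mul_neg, ← Complex.ofReal_neg, mul_comm, Complex.exp_mul_I, ← Complex.ofReal_cos,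
      ← Complex.ofReal_sin, Real.cos_neg, Real.sin_neg]
    push_cast; ring
  have hdiag : ∀ (c u v : ℂ), u * (1 / 2) * (c + star c) + v * (1 / (2 * Complex.I)) * (c - star c)
      = u * c.re + v * c.im := by
    intro c u v
    rw [Complex.star_def, Complex.add_conj, Complex.sub_conj]
    push_cast
    field_simp [Complex.I_ne_zero]
  rw [jRe, jIm, hadj, blockA, ← fromBlocks_one, fromBlocks_add, sub_eq_add_neg, fromBlocks_neg,
    fromBlocks_add]
  simp only [fromBlocks_smul, fromBlocks_add]
  congr 1
  · rw [← hdiag]; module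
  · rw [crossBlock, e1, e2]
    match_scalars <;> field_simp <;> ring_nf <;> simp
  · rw [crossBlock, e1, e2]
    match_scalars <;> field_simp <;> ring_nf <;> simp
  · rw [← hdiag]; module

/-! ### Lines and conics in line coordinates -/

/-- The equation in line coordinates of the point `c` of the plane. -/
noncomputable def lineForm (c : ℂ) : MvPolynomial (Fin 3) ℂ :=
  MvPolynomial.C (c.re : ℂ) * MvPolynomial.X 0 + MvPolynomial.C (c.im : ℂ) * MvPolynomial.X 1
    + MvPolynomial.X 2

/-- The equation in line coordinates of the conic with foci `α`, `β`, which for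
`0 < μ < |α - β| ^ 2` is the hyperbola with non-transverse axis of length `√μ`. -/
noncomputable def conicForm (α β : ℂ) (μ : ℝ) : MvPolynomial (Fin 3) ℂ :=
  lineForm α * lineForm β
    + MvPolynomial.C ((μ / 4 : ℝ) : ℂ) * (MvPolynomial.X 0 ^ 2 + MvPolynomial.X 1 ^ 2)

theorem eval_lineForm (c : ℂ) (ξ : Fin 3 → ℂ) :
    MvPolynomial.eval ξ (lineForm c) = c.re * ξ 0 + c.im * ξ 1 + ξ 2 := by
  simp [lineForm]

theorem eval_conicForm (α β : ℂ) (μ : ℝ) (ξ : Fin 3 → ℂ) :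
    MvPolynomial.eval ξ (conicForm α β μ)
      = (α.re * ξ 0 + α.im * ξ 1 + ξ 2) * (β.re * ξ 0 + β.im * ξ 1 + ξ 2)
        + (μ / 4 : ℂ) * (ξ 0 ^ 2 + ξ 1 ^ 2) := by
  simp [conicForm, eval_lineForm]

theorem polyGrad_lineForm (c : ℂ) (ξ : Fin 3 → ℂ) :
    polyGrad (lineForm c) ξ = ![(c.re : ℂ), (c.im : ℂ), 1] := by
  ext i
  fin_cases i <;> simp [polyGrad, lineForm, MvPolynomial.pderiv_X]

theorem polyGrad_conicForm (α β : ℂ) (μ : ℝ) (ξ : Fin 3 → ℂ) :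
    polyGrad (conicForm α β μ) ξ =
      ![(α.re : ℂ) * (β.re * ξ 0 + β.im * ξ 1 + ξ 2) + β.re * (α.re * ξ 0 + α.im * ξ 1 + ξ 2)
          + μ / 2 * ξ 0,
        (α.im : ℂ) * (β.re * ξ 0 + β.im * ξ 1 + ξ 2) + β.im * (α.re * ξ 0 + α.im * ξ 1 + ξ 2)
          + μ / 2 * ξ 1,
        (α.re * ξ 0 + α.im * ξ 1 + ξ 2) + (β.re * ξ 0 + β.im * ξ 1 + ξ 2)] := by
  ext i
  fin_cases i <;>
    simp [polyGrad, conicForm, lineForm, MvPolynomial.pderiv_X] <;> ring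

theorem isHomogeneous_lineForm (c : ℂ) : (lineForm c).IsHomogeneous 1 :=
  ((MvPolynomial.isHomogeneous_C_mul_X _ _).add (MvPolynomial.isHomogeneous_C_mul_X _ _)).add
    (MvPolynomial.isHomogeneous_X _ _)

theorem isHomogeneous_conicForm (α β : ℂ) (μ : ℝ) : (conicForm α β μ).IsHomogeneous 2 := by
  refine ((isHomogeneous_lineForm α).mul (isHomogeneous_lineForm β)).add ?_
  have h := ((MvPolynomial.isHomogeneous_X_pow (R := ℂ) (0 : Fin 3) 2).add
    (MvPolynomial.isHomogeneous_X_pow (1 : Fin 3) 2))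
  simpa using (MvPolynomial.isHomogeneous_C (Fin 3) ((μ / 4 : ℝ) : ℂ)).mul h

theorem lineForm_ne_zero (c : ℂ) : lineForm c ≠ 0 := fun h => by
  have := eval_lineForm c ![0, 0, 1]
  simp [h] at this

theorem conicForm_ne_zero (α β : ℂ) (μ : ℝ) : conicForm α β μ ≠ 0 := fun h => by
  have := eval_conicForm α β μ ![0, 0, 1]
  simp [h] at this

theorem irreducible_lineForm (c : ℂ) : Irreducible (lineForm c) := by
  refine MvPolynomial.irreducible_of_totalDegree_eq_one
    ((isHomogeneous_lineForm c).totalDegree (lineForm_ne_zero c)) fun x hx => ?_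
  refine IsUnit.mk0 x fun h0 => lineForm_ne_zero c ?_
  ext i
  simpa [h0] using hx i

theorem MvPolynomial.eval_eq_of_totalDegree_le_one {f : MvPolynomial (Fin 3) ℂ}
    (hf : f.totalDegree ≤ 1) : ∃ (c : ℂ) (l : Fin 3 → ℂ),
      ∀ ξ : Fin 3 → ℂ, MvPolynomial.eval ξ f = c + (l 0 * ξ 0 + l 1 * ξ 1 + l 2 * ξ 2) := by
  have h : f = MvPolynomial.C (f.coeff 0)
      + ∑ i, MvPolynomial.C (f.coeff (Finsupp.single i 1)) * MvPolynomial.X i := by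
    ext d
    simp only [MvPolynomial.coeff_add, MvPolynomial.coeff_sum, MvPolynomial.coeff_C_mul,
      MvPolynomial.coeff_C, MvPolynomial.coeff_X]
    rcases Nat.lt_or_ge 1 d.degree with hd | hd
    · rw [MvPolynomial.coeff_eq_zero_of_totalDegree_lt
        (hf.trans_lt (by rwa [Finsupp.degree] at hd))]
      have h0 : d ≠ 0 := by rintro rfl; simp at hd
      have h1 : ∀ i, Finsupp.single i 1 ≠ d := by rintro i rfl; simp at hd
      simp [h0.symm, h1]
    · rcases Nat.le_one_iff_eq_zero_or_eq_one.1 hd with h0 | h1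
      · rw [Finsupp.degree_eq_zero_iff] at h0
        subst h0
        simp
      · obtain ⟨i, rfl⟩ : d ∈ Set.range fun i : Fin 3 => Finsupp.single i 1 := by
          rwa [Finsupp.range_single_one]
        have hne : (0 : Fin 3 →₀ ℕ) ≠ Finsupp.single i 1 :=
          (Finsupp.single_ne_zero.2 one_ne_zero).symm
        simp [Finsupp.single_left_inj, hne]
  refine ⟨f.coeff 0, fun i => f.coeff (Finsupp.single i 1), fun ξ => ?_⟩
  conv_lhs => rw [h]
  simp [Fin.sum_univ_three]

/-- If the conic split, it would be a product of two linear forms, and these have vanishing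
discriminant; that of `conicForm α β μ` is `μ (μ - |α - β| ^ 2) / 4`. -/
theorem irreducible_conicForm {α β : ℂ} {μ : ℝ} (hμ : μ ≠ 0) (hlt : μ ≠ ‖α - β‖ ^ 2) :
    Irreducible (conicForm α β μ) := by
  have hdeg := (isHomogeneous_conicForm α β μ).totalDegree (conicForm_ne_zero α β μ)
  have hunit : ∀ f : MvPolynomial (Fin 3) ℂ, f ≠ 0 → ¬ IsUnit f → f.totalDegree ≠ 0 := by
    intro f hf hu h0
    rw [MvPolynomial.totalDegree_eq_zero_iff_eq_C] at h0
    rw [h0, map_ne_zero_iff _ (MvPolynomial.C_injective _ _)] at hf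
    exact hu (h0 ▸ (IsUnit.mk0 _ hf).map MvPolynomial.C)
  refine ⟨fun hu => ?_, fun f g hfg => ?_⟩
  · have := (MvPolynomial.isUnit_iff_totalDegree_of_isReduced.mp hu).2
    omega
  by_contra! hcon
  have hf0 : f ≠ 0 := by rintro rfl; exact conicForm_ne_zero α β μ (by simpa using hfg)
  have hg0 : g ≠ 0 := by rintro rfl; exact conicForm_ne_zero α β μ (by simpa using hfg)
  rw [hfg, MvPolynomial.totalDegree_mul_of_isDomain hf0 hg0] at hdeg
  have hf1 := hunit f hf0 hcon.1
  have hg1 := hunit g hg0 hcon.2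
  obtain ⟨c, l, hl⟩ := MvPolynomial.eval_eq_of_totalDegree_le_one (f := f) (by omega)
  obtain ⟨c', l', hl'⟩ := MvPolynomial.eval_eq_of_totalDegree_le_one (f := g) (by omega)
  have hev : ∀ x y z : ℂ, (α.re * x + α.im * y + z) * (β.re * x + β.im * y + z)
        + (μ / 4 : ℂ) * (x ^ 2 + y ^ 2)
      = (c + (l 0 * x + l 1 * y + l 2 * z)) * (c' + (l' 0 * x + l' 1 * y + l' 2 * z)) := by
    intro x y z
    have := congrArg (MvPolynomial.eval ![x, y, z]) hfg
    rw [map_mul, eval_conicForm, hl, hl'] at this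
    simpa using this
  have hq : ∀ x y z : ℂ, (α.re * x + α.im * y + z) * (β.re * x + β.im * y + z)
        + (μ / 4 : ℂ) * (x ^ 2 + y ^ 2)
      = (l 0 * x + l 1 * y + l 2 * z) * (l' 0 * x + l' 1 * y + l' 2 * z) := by
    intro x y z
    linear_combination (hev x y z + hev (-x) (-y) (-z)) / 2 - hev 0 0 0
  have h00 := hq 1 0 0
  have h11 := hq 0 1 0
  have h22 := hq 0 0 1
  have h01 := hq 1 1 0
  have h02 := hq 1 0 1
  have h12 := hq 0 1 1
  simp only [mul_one, mul_zero, add_zero, zero_add, one_pow, ne_eq, OfNat.ofNat_ne_zero,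
    not_false_eq_true, zero_pow] at h00 h11 h22 h01 h02 h12
  -- The six coefficients of the product of the two linear forms.
  have a01 : l 0 * l' 1 + l 1 * l' 0 = α.re * β.im + α.im * β.re := by
    linear_combination h00 + h11 - h01
  have a02 : l 0 * l' 2 + l 2 * l' 0 = α.re + β.re := by
    linear_combination h00 + h22 - h02
  have a12 : l 1 * l' 2 + l 2 * l' 1 = α.im + β.im := by
    linear_combination h11 + h22 - h12
  have hdisc : 4 * (l 0 * l' 0) * (l 1 * l' 1) * (l 2 * l' 2)
      + (l 0 * l' 1 + l 1 * l' 0) * (l 1 * l' 2 + l 2 * l' 1) * (l 0 * l' 2 + l 2 * l' 0)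
      - (l 0 * l' 0) * (l 1 * l' 2 + l 2 * l' 1) ^ 2
      - (l 1 * l' 1) * (l 0 * l' 2 + l 2 * l' 0) ^ 2
      - (l 2 * l' 2) * (l 0 * l' 1 + l 1 * l' 0) ^ 2 = 0 := by ring
  rw [a01, a02, a12, ← h00, ← h11, ← h22] at hdisc
  have hzero : ((μ / 4 * (μ - ((α.re - β.re) ^ 2 + (α.im - β.im) ^ 2)) : ℝ) : ℂ) = 0 := by
    push_cast
    linear_combination hdisc
  have hn : ‖α - β‖ ^ 2 = (α.re - β.re) ^ 2 + (α.im - β.im) ^ 2 := by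
    rw [Complex.sq_norm, Complex.normSq_apply]; simp; ring
  rw [← hn] at hzero
  rcases mul_eq_zero.1 (Complex.ofReal_eq_zero.1 hzero) with h | h
  · exact hμ (by linarith)
  · exact hlt (by linarith)

/-! ### Dual curves -/

theorem MvPolynomial.IsHomogeneous.eval_smul {σ R : Type*} [CommSemiring R] {φ : MvPolynomial σ R}
    {d : ℕ} (hφ : φ.IsHomogeneous d) (k : R) (x : σ → R) :
    MvPolynomial.eval (k • x) φ = k ^ d * MvPolynomial.eval x φ := by
  rw [MvPolynomial.eval_eq, MvPolynomial.eval_eq, Finset.mul_sum]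
  refine Finset.sum_congr rfl fun e he => ?_
  have hd : e.degree = d := by
    rw [Finsupp.degree_eq_weight_one]
    exact hφ (MvPolynomial.mem_support_iff.1 he)
  simp only [Pi.smul_apply, smul_eq_mul, mul_pow, Finset.prod_mul_distrib,
    Finset.prod_pow_eq_pow_sum]
  rw [← Finsupp.degree_apply, hd]
  ring

theorem dualCurve_eq_of_associated {p q : MvPolynomial (Fin 3) ℂ} (h : Associated p q) :
    dualCurve p = dualCurve q := by
  obtain ⟨u, rfl⟩ := h
  obtain ⟨hc, hc'⟩ := MvPolynomial.isUnit_iff_totalDegree_of_isReduced.mp u.isUnit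
  obtain ⟨k, hk⟩ : ∃ k : ℂ, (u : MvPolynomial (Fin 3) ℂ) = MvPolynomial.C k :=
    ⟨_, MvPolynomial.totalDegree_eq_zero_iff_eq_C.1 hc'⟩
  have hk0 : k ≠ 0 := by
    rintro rfl
    exact u.ne_zero (by rw [hk, map_zero])
  have hgrad : ∀ ξ, polyGrad (p * MvPolynomial.C k) ξ = k • polyGrad p ξ := by
    intro ξ
    ext i
    simp [polyGrad]
  ext P
  simp only [dualCurve, Set.mem_ofPred_eq]
  refine and_congr_right fun _ => forall_congr' fun d => forall_congr' fun G =>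
    imp_congr_right fun hG => imp_congr_left (forall_congr' fun ξ => ?_)
  have hsmul : MvPolynomial.eval (k • polyGrad p ξ) G
      = k ^ d * MvPolynomial.eval (polyGrad p ξ) G := by
    exact MvPolynomial.IsHomogeneous.eval_smul hG _ _
  rw [hk, hgrad, map_mul, MvPolynomial.eval_C, mul_eq_zero, or_iff_left hk0, hsmul, mul_eq_zero,
    or_iff_right (pow_ne_zero d hk0), smul_ne_zero_iff_right hk0]

theorem realDualCurve_lineForm (c : ℂ) : realDualCurve (lineForm c) = {c} := by
  ext z
  rw [Set.mem_singleton_iff]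
  constructor
  · rintro ⟨-, h⟩
    have h0 := h 1 (MvPolynomial.X 0 - MvPolynomial.C (c.re : ℂ) * MvPolynomial.X 2)
      ((MvPolynomial.isHomogeneous_X _ _).sub (MvPolynomial.isHomogeneous_C_mul_X _ _))
      (fun ξ _ _ => by simp [polyGrad_lineForm])
    have h1 := h 1 (MvPolynomial.X 1 - MvPolynomial.C (c.im : ℂ) * MvPolynomial.X 2)
      ((MvPolynomial.isHomogeneous_X _ _).sub (MvPolynomial.isHomogeneous_C_mul_X _ _))
      (fun ξ _ _ => by simp [polyGrad_lineForm])
    simp [sub_eq_zero] at h0 h1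
    exact Complex.ext h0 h1
  · rintro rfl
    refine ⟨fun h => by simpa using congrFun h 2, fun d G _ hG => ?_⟩
    have := hG ![1, 0, -z.re] (by simp [eval_lineForm]) (by
      rw [polyGrad_lineForm]; exact fun h => by simpa using congrFun h 2)
    rwa [polyGrad_lineForm] at this

/-- The point equation of the conic `conicForm α β μ`, i.e. `hyperbolaForm` made homogeneous. -/
noncomputable def dualConicForm (α β : ℂ) (μ : ℝ) : MvPolynomial (Fin 3) ℂ :=
  let E₀ := MvPolynomial.C 2 * MvPolynomial.X 0
    - MvPolynomial.C ((α.re + β.re : ℝ) : ℂ) * MvPolynomial.X 2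
  let E₁ := MvPolynomial.C 2 * MvPolynomial.X 1
    - MvPolynomial.C ((α.im + β.im : ℝ) : ℂ) * MvPolynomial.X 2
  (MvPolynomial.C ((α.re - β.re : ℝ) : ℂ) * E₀ + MvPolynomial.C ((α.im - β.im : ℝ) : ℂ) * E₁) ^ 2
    - MvPolynomial.C ((‖α - β‖ ^ 2 - μ : ℝ) : ℂ) *
      (E₀ ^ 2 + E₁ ^ 2 + MvPolynomial.C (μ : ℂ) * MvPolynomial.X 2 ^ 2)

theorem isHomogeneous_dualConicForm (α β : ℂ) (μ : ℝ) :
    (dualConicForm α β μ).IsHomogeneous 2 := by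
  have hC : ∀ (c : ℂ) {p : MvPolynomial (Fin 3) ℂ} {n : ℕ}, p.IsHomogeneous n →
      (MvPolynomial.C c * p).IsHomogeneous n := fun c p n hp => by
    simpa using (MvPolynomial.isHomogeneous_C (Fin 3) c).mul hp
  have hE : ∀ (c : ℂ) (i : Fin 3),
      (MvPolynomial.C 2 * MvPolynomial.X i - MvPolynomial.C c * MvPolynomial.X 2 :
        MvPolynomial (Fin 3) ℂ).IsHomogeneous 1 := fun c i =>
    (hC _ (MvPolynomial.isHomogeneous_X _ _)).sub (hC _ (MvPolynomial.isHomogeneous_X _ _))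
  exact (((hC _ (hE _ 0)).add (hC _ (hE _ 1))).pow 2).sub (hC _ ((((hE _ 0).pow 2).add
    ((hE _ 1).pow 2)).add (hC _ (MvPolynomial.isHomogeneous_X_pow _ _))))

theorem ofReal_sq_norm_sub (α β : ℂ) :
    ((‖α - β‖ ^ 2 : ℝ) : ℂ) = ((α.re : ℂ) - β.re) ^ 2 + ((α.im : ℂ) - β.im) ^ 2 := by
  rw [Complex.sq_norm, Complex.normSq_apply]; simp; ring

theorem eval_polyGrad_dualConicForm (α β : ℂ) (μ : ℝ) (ξ : Fin 3 → ℂ) :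
    MvPolynomial.eval (polyGrad (conicForm α β μ) ξ) (dualConicForm α β μ)
      = -4 * μ * ((‖α - β‖ ^ 2 - μ : ℝ) : ℂ) * MvPolynomial.eval ξ (conicForm α β μ) := by
  rw [polyGrad_conicForm, eval_conicForm, dualConicForm, Complex.ofReal_sub (‖α - β‖ ^ 2),
    ofReal_sq_norm_sub]
  simp
  ring

theorem eval_dualConicForm (α β : ℂ) {μ N : ℝ} (hN : N ^ 2 = ‖α - β‖ ^ 2 - μ) (z : ℂ) :
    MvPolynomial.eval ![(z.re : ℂ), (z.im : ℂ), 1] (dualConicForm α β μ)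
      = (hyperbolaForm α β N z : ℂ) := by
  have h : hyperbolaForm α β N z
      = ((α.re - β.re) * (2 * z.re - α.re - β.re) + (α.im - β.im) * (2 * z.im - α.im - β.im)) ^ 2
        - (‖α - β‖ ^ 2 - μ) *
          ((2 * z.re - α.re - β.re) ^ 2 + (2 * z.im - α.im - β.im) ^ 2 + μ) := by
    rw [hyperbolaForm, hN, Complex.sq_norm (2 * z - α - β), Complex.normSq_apply]
    simp only [Complex.sub_re, Complex.sub_im, Complex.mul_re, Complex.mul_im,
      Complex.re_ofNat, Complex.im_ofNat]
    ring
  rw [h, dualConicForm]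
  simp only [map_sub, map_add, map_mul, map_pow, MvPolynomial.eval_C, MvPolynomial.eval_X]
  simp only [cons_val]
  push_cast
  ring

/-- The curve with line equation `conicForm α β μ` is a hyperbola: every point of it is the
pole of a line, so that no closure has to be taken. -/
theorem realDualCurve_conicForm {α β : ℂ} {μ N : ℝ} (hμ : 0 < μ) (hN : 0 < N)
    (h : N ^ 2 + μ = ‖α - β‖ ^ 2) : realDualCurve (conicForm α β μ) = hyperbola α β N := by
  have hlt : N < ‖α - β‖ := transverse_lt (Real.sqrt_pos.2 hμ) (norm_nonneg _)
    (by rw [Real.sq_sqrt hμ.le, h])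
  have hN' : N ^ 2 = ‖α - β‖ ^ 2 - μ := by linarith
  have hμ0 : (μ : ℂ) ≠ 0 := by exact_mod_cast hμ.ne'
  have hd0 : ((‖α - β‖ ^ 2 - μ : ℝ) : ℂ) ≠ 0 := by
    rw [← hN']; exact_mod_cast (pow_pos hN 2).ne'
  ext z
  rw [mem_hyperbola_iff hN.le hlt, ← Complex.ofReal_eq_zero, ← eval_dualConicForm α β hN']
  constructor
  · rintro ⟨-, hP⟩
    refine hP 2 _ (isHomogeneous_dualConicForm α β μ) fun ξ hξ _ => ?_
    rw [eval_polyGrad_dualConicForm, hξ, mul_zero]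
  · intro hz
    have hP0 : ![(z.re : ℂ), (z.im : ℂ), 1] ≠ 0 := fun h => by simpa using congrFun h 2
    obtain ⟨ξ, hξ⟩ : ∃ ξ, polyGrad (conicForm α β μ) ξ = ![(z.re : ℂ), (z.im : ℂ), 1] := by
      -- `t` is the difference of the two linear forms at `ξ`; their sum has to be `1`.
      obtain ⟨t, ht⟩ : ∃ t : ℂ, t * (μ - (((α.re : ℂ) - β.re) ^ 2 + ((α.im : ℂ) - β.im) ^ 2))
          = (α.re - β.re) * (2 * z.re - α.re - β.re)
            + (α.im - β.im) * (2 * z.im - α.im - β.im) := by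
        refine ⟨_, div_mul_cancel₀ _ ?_⟩
        rw [← ofReal_sq_norm_sub, ← Complex.ofReal_sub, ← neg_sub (‖α - β‖ ^ 2), Complex.ofReal_neg]
        exact neg_ne_zero.2 hd0
      let u : ℂ := (2 * z.re - α.re - β.re + (α.re - β.re) * t) / μ
      let v : ℂ := (2 * z.im - α.im - β.im + (α.im - β.im) * t) / μ
      have hu : μ * u = 2 * z.re - α.re - β.re + (α.re - β.re) * t := mul_div_cancel₀ _ hμ0
      have hv : μ * v = 2 * z.im - α.im - β.im + (α.im - β.im) * t := mul_div_cancel₀ _ hμ0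
      have htuv : (α.re - β.re) * u + (α.im - β.im) * v = t := by
        apply mul_left_cancel₀ hμ0
        linear_combination (α.re - β.re) * hu + (α.im - β.im) * hv - ht
      refine ⟨![u, v, (1 + t) / 2 - α.re * u - α.im * v], ?_⟩
      rw [polyGrad_conicForm]
      ext i
      fin_cases i
      · simp
        linear_combination hu / 2 - α.re * htuv
      · simp
        linear_combination hv / 2 - α.im * htuv
      · simp
        linear_combination -htuv
    refine ⟨hP0, fun d G _ hG => ?_⟩
    rw [← hξ]
    refine hG ξ ?_ (hξ ▸ hP0)
    rw [← hξ, eval_polyGrad_dualConicForm] at hz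
    exact (mul_eq_zero.1 hz).resolve_left
      (mul_ne_zero (mul_ne_zero (by norm_num) hμ0) hd0)

/-! ### Factorization of the Kippenhahn polynomial -/

theorem eval_kippenhahnPoly {ι : Type*} [Fintype ι] [DecidableEq ι] (J A : Matrix ι ι ℂ)
    (ξ : Fin 3 → ℂ) : MvPolynomial.eval ξ (kippenhahnPoly J A)
      = (ξ 0 • jRe J A + ξ 1 • jIm J A + ξ 2 • 1).det := by
  rw [kippenhahnPoly, RingHom.map_det]
  congr 1
  ext i j
  by_cases h : i = j <;> simp [h]

/-- Polynomials in line coordinates are determined by their values on real lines, given in polar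
coordinates. -/
theorem MvPolynomial.eq_of_eval_polar {p q : MvPolynomial (Fin 3) ℂ}
    (h : ∀ ρ θ w : ℝ, MvPolynomial.eval
        ![((ρ * Real.cos θ : ℝ) : ℂ), ((ρ * Real.sin θ : ℝ) : ℂ), (w : ℂ)] p
      = MvPolynomial.eval
        ![((ρ * Real.cos θ : ℝ) : ℂ), ((ρ * Real.sin θ : ℝ) : ℂ), (w : ℂ)] q) : p = q := by
  refine MvPolynomial.funext_set (fun _ => Set.range ((↑) : ℝ → ℂ))
    (fun _ => Set.infinite_range_of_injective Complex.ofReal_injective) fun x hx => ?_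
  obtain ⟨u, hu⟩ := hx 0 trivial
  obtain ⟨v, hv⟩ := hx 1 trivial
  obtain ⟨w, hw⟩ := hx 2 trivial
  have := h ‖(⟨u, v⟩ : ℂ)‖ (Complex.arg ⟨u, v⟩) w
  rw [Complex.norm_mul_cos_arg, Complex.norm_mul_sin_arg] at this
  have hx' : x = ![(u : ℂ), (v : ℂ), (w : ℂ)] := by
    ext i
    fin_cases i
    exacts [hu.symm, hv.symm, hw.symm]
  rwa [hx']

/-- At a real line the product of the conics is the determinant of the Schur complement. The
eigenvalues of `M(0)` may be used in every direction `θ`, because `M(θ)` has the same characteristic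
polynomial. -/
theorem eval_prod_conicForm {r n : ℕ} {C : Matrix (Fin r) (Fin n) ℂ}
    {D : Matrix (Fin n) (Fin r) ℂ} (α β : ℂ)
    (hspec : ∀ θ θ', spectrum ℂ (blockM C D θ) = spectrum ℂ (blockM C D θ')) (ρ θ w : ℝ) :
    MvPolynomial.eval ![((ρ * Real.cos θ : ℝ) : ℂ), ((ρ * Real.sin θ : ℝ) : ℂ), (w : ℂ)]
        (∏ i, conicForm α β ((isHermitian_blockM C D 0).eigenvalues i))
      = ((MvPolynomial.eval ![((ρ * Real.cos θ : ℝ) : ℂ), ((ρ * Real.sin θ : ℝ) : ℂ), (w : ℂ)]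
          (lineForm α * lineForm β)) • (1 : Matrix (Fin n) (Fin n) ℂ)
          - ((ρ / 2 : ℂ) • crossBlock D C θ) * ((ρ / 2 : ℂ) • crossBlock C D θ)).det := by
  have hchar := charpoly_eq_of_spectrum_eq (continuous_blockM C D)
    (isHermitian_blockM C D) hspec θ 0
  rw [(isHermitian_blockM C D 0).charpoly_eq] at hchar
  have hQP : ((ρ / 2 : ℂ) • crossBlock D C θ) * ((ρ / 2 : ℂ) • crossBlock C D θ)
      = -((ρ ^ 2 / 4 : ℂ) • blockM C D θ) := by
    rw [blockM_eq, crossBlock_conjTranspose, Matrix.smul_mul, Matrix.mul_smul, smul_smul,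
      Matrix.neg_mul, smul_neg, neg_neg]
    congr 1
    ring
  rw [hQP, sub_neg_eq_add, det_smul_one_add_smul hchar, map_prod]
  refine Finset.prod_congr rfl fun i _ => ?_
  have hρ : (Real.cos θ : ℂ) ^ 2 + (Real.sin θ : ℂ) ^ 2 = 1 := by
    exact_mod_cast Real.cos_sq_add_sin_sq θ
  rw [eval_conicForm, map_mul, eval_lineForm, eval_lineForm]
  simp only [cons_val, RCLike.ofReal_eq_complex_ofReal]
  push_cast at hρ ⊢
  linear_combination (ρ ^ 2 * ((isHermitian_blockM C D 0).eigenvalues i : ℂ) / 4) * hρ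

theorem kippenhahnPoly_mul_lineForm_left {r s : ℕ} {C : Matrix (Fin r) (Fin s) ℂ}
    {D : Matrix (Fin s) (Fin r) ℂ} (α β : ℂ)
    (hspec : ∀ θ θ', spectrum ℂ (blockM C D θ) = spectrum ℂ (blockM C D θ')) :
    kippenhahnPoly (blockJ r s) (blockA α β C D) * lineForm α ^ s
      = lineForm α ^ r *
        ∏ i, conicForm α β ((isHermitian_blockM C D 0).eigenvalues i) := by
  refine MvPolynomial.eq_of_eval_polar fun ρ θ w => ?_
  rw [map_mul, map_mul, eval_prod_conicForm α β hspec, eval_kippenhahnPoly]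
  simp only [cons_val]
  rw [pencil_eq_fromBlocks, map_pow, map_pow, map_mul, eval_lineForm, eval_lineForm]
  simp only [cons_val, mul_comm _ (Complex.ofReal (Complex.re _)),
    mul_comm _ (Complex.ofReal (Complex.im _))]
  exact det_fromBlocks_smul_one₁₁ _ _ _ _

theorem kippenhahnPoly_mul_lineForm_right {r s : ℕ} {C : Matrix (Fin r) (Fin s) ℂ}
    {D : Matrix (Fin s) (Fin r) ℂ} (α β : ℂ)
    (hspec : ∀ θ θ', spectrum ℂ (blockM D C θ) = spectrum ℂ (blockM D C θ')) :
    kippenhahnPoly (blockJ r s) (blockA α β C D) * lineForm β ^ r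
      = lineForm β ^ s *
        ∏ i, conicForm α β ((isHermitian_blockM D C 0).eigenvalues i) := by
  refine MvPolynomial.eq_of_eval_polar fun ρ θ w => ?_
  rw [map_mul, map_mul, eval_prod_conicForm α β hspec, eval_kippenhahnPoly]
  simp only [cons_val]
  rw [pencil_eq_fromBlocks, map_pow, map_pow, map_mul, eval_lineForm, eval_lineForm]
  simp only [cons_val, mul_comm _ (Complex.ofReal (Complex.re _)),
    mul_comm _ (Complex.ofReal (Complex.im _))]
  exact det_fromBlocks_smul_one₂₂ _ _ _ _

/-! ### Hyperbolic components -/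

section Bound
open scoped Matrix.Norms.L2Operator

theorem eigenvalues_le_of_mem_specM {r s : ℕ} (hr : 0 < r) (hs : 0 < s)
    {C : Matrix (Fin r) (Fin s) ℂ} {D : Matrix (Fin s) (Fin r) ℂ} {μ : ℝ}
    (hμ : (μ : ℂ) ∈ specM C D 0) : μ ≤ spectralNormMat (C - Dᴴ) ^ 2 := by
  have : Nonempty (Fin r) := ⟨⟨0, hr⟩⟩
  have : Nonempty (Fin s) := ⟨⟨0, hs⟩⟩
  have hle : ‖(μ : ℂ)‖ ≤ ‖crossBlock C D 0‖ * ‖crossBlock C D 0‖ := by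
    by_cases h : s ≤ r
    · rw [specM, if_pos h, blockM_eq] at hμ
      rw [← l2_opNorm_conjTranspose_mul_self]
      exact spectrum.norm_le_norm_of_mem hμ
    · rw [specM, if_neg h, blockM_swap_eq] at hμ
      rw [← l2_opNorm_conjTranspose, ← l2_opNorm_conjTranspose_mul_self,
        conjTranspose_conjTranspose]
      exact spectrum.norm_le_norm_of_mem hμ
  rw [Complex.norm_real, crossBlock_zero, ← sq] at hle
  exact (Real.le_norm_self μ).trans hle

end Bound

/-- Up to powers of the line equation of one focus, the Kippenhahn polynomial is the product of the
conics belonging to the eigenvalues of `M(0)`. -/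
theorem exists_kippenhahnPoly_factorization {r s : ℕ} (α β : ℂ) {C : Matrix (Fin r) (Fin s) ℂ}
    {D : Matrix (Fin s) (Fin r) ℂ} (hspec : ∀ θ θ' : ℝ, specM C D θ = specM C D θ') :
    ∃ (c : ℂ) (i j n : ℕ) (μ : Fin n → ℝ),
      kippenhahnPoly (blockJ r s) (blockA α β C D) * lineForm c ^ i
        = lineForm c ^ j * ∏ t, conicForm α β (μ t) ∧
      (∀ t, 0 ≤ μ t) ∧ ∀ x : ℂ, x ∈ specM C D 0 ↔ ∃ t, x = μ t := by
  by_cases h : s ≤ r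
  · simp only [specM, if_pos h] at hspec ⊢
    exact ⟨α, _, _, _, _, kippenhahnPoly_mul_lineForm_left α β hspec,
      eigenvalues_blockM_nonneg C D 0,
      mem_spectrum_iff_eigenvalues (isHermitian_blockM C D 0)⟩
  · simp only [specM, if_neg h] at hspec ⊢
    exact ⟨β, _, _, _, _, kippenhahnPoly_mul_lineForm_right α β hspec,
      eigenvalues_blockM_nonneg D C 0,
      mem_spectrum_iff_eigenvalues (isHermitian_blockM D C 0)⟩

/-- The factors that are line equations of a focus contribute single points to the curve. -/
theorem not_isHyperbola_of_dvd_lineForm {p : MvPolynomial (Fin 3) ℂ} (hp : Irreducible p) {c : ℂ}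
    (h : p ∣ lineForm c) : ¬ IsHyperbola (realDualCurve p) := by
  intro hK
  have hass := hp.associated_of_dvd (irreducible_lineForm c) h
  refine hK.ne_singleton c ?_
  rw [← realDualCurve_lineForm, realDualCurve, dualCurve_eq_of_associated hass, realDualCurve]

theorem isHyperbolaWith_realDualCurve_conicForm {α β : ℂ} {μ m : ℝ} (hμ : 0 < μ)
    (hm : 0 ≤ m) (hle : μ ≤ m ^ 2) (hlt : m < ‖α - β‖) :
    IsHyperbolaWith (realDualCurve (conicForm α β μ)) α β (Real.sqrt μ) := by
  have hpos : 0 < ‖α - β‖ ^ 2 - μ := by nlinarith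
  have h : Real.sqrt (‖α - β‖ ^ 2 - μ) ^ 2 + μ = ‖α - β‖ ^ 2 := by
    rw [Real.sq_sqrt hpos.le]; ring
  exact ⟨_, Real.sqrt_pos.2 hpos, Real.sqrt_pos.2 hμ, by rw [Real.sq_sqrt hμ.le, h],
    realDualCurve_conicForm hμ (Real.sqrt_pos.2 hpos) h⟩

theorem exists_eigenvalue_of_mem_hyperbolicComponents {r s : ℕ} (hr : 0 < r) (hs : 0 < s)
    {α β : ℂ} {C : Matrix (Fin r) (Fin s) ℂ} {D : Matrix (Fin s) (Fin r) ℂ}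
    (hspec : ∀ θ θ' : ℝ, specM C D θ = specM C D θ')
    (hlt : spectralNormMat (C - Dᴴ) < ‖α - β‖) {K : Set ℂ}
    (hK : K ∈ hyperbolicComponents (blockJ r s) (blockA α β C D)) :
    ∃ μ : ℝ, (μ : ℂ) ∈ specM C D 0 ∧ μ ≠ 0 ∧ IsHyperbolaWith K α β (Real.sqrt μ) := by
  have hm : 0 ≤ spectralNormMat (C - Dᴴ) := by
    open scoped Matrix.Norms.L2Operator in exact norm_nonneg (C - Dᴴ)
  obtain ⟨⟨p, hp, hdvd, rfl⟩, hhyp⟩ := hK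
  obtain ⟨c, i, j, n, μ, hfac, hμ0, hμ⟩ := exists_kippenhahnPoly_factorization α β hspec
  have hprime := hp.prime
  have h1 : p ∣ lineForm c ^ j * ∏ t, conicForm α β (μ t) := hfac ▸ hdvd.mul_right _
  rcases hprime.dvd_or_dvd h1 with h2 | h2
  · exact absurd hhyp (not_isHyperbola_of_dvd_lineForm hp (hprime.dvd_of_dvd_pow h2))
  · obtain ⟨t, -, ht⟩ := (hprime.dvd_finsetProd_iff _).1 h2
    have hmem : (μ t : ℂ) ∈ specM C D 0 := (hμ _).2 ⟨t, rfl⟩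
    have hle := eigenvalues_le_of_mem_specM hr hs hmem
    rcases (hμ0 t).eq_or_lt with h0 | h0
    · -- For `μ = 0` the conic is the pair of foci.
      have hsplit : conicForm α β (μ t) = lineForm α * lineForm β := by
        rw [conicForm, ← h0]; simp
      rw [hsplit] at ht
      exact absurd hhyp ((hprime.dvd_or_dvd ht).elim (not_isHyperbola_of_dvd_lineForm hp)
        (not_isHyperbola_of_dvd_lineForm hp))
    · have hass := hp.associated_of_dvd
        (irreducible_conicForm (α := α) (β := β) h0.ne' (by nlinarith)) ht
      refine ⟨μ t, hmem, h0.ne', ?_⟩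
      rw [realDualCurve, dualCurve_eq_of_associated hass]
      exact isHyperbolaWith_realDualCurve_conicForm h0 hm hle hlt

theorem exists_hyperbolicComponent_of_eigenvalue {r s : ℕ} (hr : 0 < r) (hs : 0 < s)
    {α β : ℂ} {C : Matrix (Fin r) (Fin s) ℂ} {D : Matrix (Fin s) (Fin r) ℂ}
    (hspec : ∀ θ θ' : ℝ, specM C D θ = specM C D θ')
    (hlt : spectralNormMat (C - Dᴴ) < ‖α - β‖) {μ : ℝ} (hmem : (μ : ℂ) ∈ specM C D 0)
    (hμ0 : μ ≠ 0) :
    ∃ K ∈ hyperbolicComponents (blockJ r s) (blockA α β C D),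
      IsHyperbolaWith K α β (Real.sqrt μ) := by
  have hm : 0 ≤ spectralNormMat (C - Dᴴ) := by
    open scoped Matrix.Norms.L2Operator in exact norm_nonneg (C - Dᴴ)
  have hle := eigenvalues_le_of_mem_specM hr hs hmem
  obtain ⟨c, i, j, n, ν, hfac, hν0, hν⟩ := exists_kippenhahnPoly_factorization α β hspec
  obtain ⟨t, ht⟩ := (hν _).1 hmem
  obtain rfl : μ = ν t := by exact_mod_cast ht
  have hpos : 0 < ν t := (hν0 t).lt_of_ne' hμ0
  have hirr : Irreducible (conicForm α β (ν t)) := irreducible_conicForm hμ0 (by nlinarith)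
  have hK := isHyperbolaWith_realDualCurve_conicForm hpos hm hle hlt
  refine ⟨_, ⟨⟨_, hirr, ?_, rfl⟩, α, β, _, hK⟩, hK⟩
  have h1 : conicForm α β (ν t) ∣
      kippenhahnPoly (blockJ r s) (blockA α β C D) * lineForm c ^ i :=
    hfac ▸ (Finset.dvd_prod_of_mem (fun t => conicForm α β (ν t)) (Finset.mem_univ t)).mul_left _
  refine (hirr.prime.dvd_or_dvd h1).resolve_right fun h2 => ?_
  exact not_isHyperbola_of_dvd_lineForm hirr (hirr.prime.dvd_of_dvd_pow h2) ⟨α, β, _, hK⟩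

theorem mainTheorem3 (r s : ℕ) (hr : 0 < r) (hs : 0 < s) (α β : ℂ) (hαβ : α ≠ β)
    (C : Matrix (Fin r) (Fin s) ℂ) (D : Matrix (Fin s) (Fin r) ℂ)
    (hCD : C ≠ 0 ∨ D ≠ 0)
    (hspec : ∀ θ θ' : ℝ, specM C D θ = specM C D θ') :
    (IsHyperbolicDiscWith (kreinRange (blockJ r s) (blockA α β C D)) α β
        (spectralNormMat (C - D.conjTranspose))
      ↔ spectralNormMat (C - D.conjTranspose) < ‖α - β‖) ∧
    (spectralNormMat (C - D.conjTranspose) < ‖α - β‖ →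
      (∀ K ∈ hyperbolicComponents (blockJ r s) (blockA α β C D),
        ∃ μ : ℝ, (μ : ℂ) ∈ specM C D 0 ∧ μ ≠ 0 ∧ IsHyperbolaWith K α β (Real.sqrt μ)) ∧
      (∀ μ : ℝ, (μ : ℂ) ∈ specM C D 0 → μ ≠ 0 →
        ∃ K ∈ hyperbolicComponents (blockJ r s) (blockA α β C D),
          IsHyperbolaWith K α β (Real.sqrt μ)) ∧
      (∀ K ∈ hyperbolicComponents (blockJ r s) (blockA α β C D),
        ∀ K' ∈ hyperbolicComponents (blockJ r s) (blockA α β C D),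
          K ≠ K' → HyperbolaInside K K' ∨ HyperbolaInside K' K)) := by
  have hm := spectralNormMat_sub_pos hCD hspec
  refine ⟨⟨?_, fun hlt => ?_⟩, fun hlt => ⟨?_, ?_, ?_⟩⟩
  · rintro ⟨N, hN, -, h, -⟩
    exact transverse_lt hN (norm_nonneg _) (by rw [add_comm, h])
  · have hpos : 0 < ‖α - β‖ ^ 2 - spectralNormMat (C - Dᴴ) ^ 2 := by nlinarith
    have h : Real.sqrt (‖α - β‖ ^ 2 - spectralNormMat (C - Dᴴ) ^ 2) ^ 2
        + spectralNormMat (C - Dᴴ) ^ 2 = ‖α - β‖ ^ 2 := by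
      rw [Real.sq_sqrt hpos.le]; ring
    exact ⟨_, Real.sqrt_pos.2 hpos, hm, h,
      kreinRange_blockA_eq hs hCD hspec (Real.sqrt_pos.2 hpos) h⟩
  · exact fun K hK => exists_eigenvalue_of_mem_hyperbolicComponents hr hs hspec hlt hK
  · exact fun μ hμ hμ0 => exists_hyperbolicComponent_of_eigenvalue hr hs hspec hlt hμ hμ0
  · intro K hK K' hK' hne
    obtain ⟨μ, -, -, h⟩ := exists_eigenvalue_of_mem_hyperbolicComponents hr hs hspec hlt hK
    obtain ⟨μ', -, -, h'⟩ := exists_eigenvalue_of_mem_hyperbolicComponents hr hs hspec hlt hK'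
    exact h.inside_or_inside h' hne
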